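/- Let $(\tilde M,\tilde g)$ be a smooth Lorentzian manifold of dimension $m\ge 3$, let $\tilde\ell$ be a smooth null vector field on $\tilde M$, and let $\eta:\tilde M\to\mathbb R$ be a nowhere vanishing function. Assume that $\tilde M$ is an aligned algebraically special Ricci type N spacetime, that is: (a) at every point $\tilde\ell$ is a multiple Weyl aligned null direction (mWAND): in a null frame $(\tilde\ell,\tilde n,\tilde m_{(i)})$, with $\tilde\ell\cdot\tilde n=1$, $\tilde m_{(i)}\cdot\tilde m_{(j)}=\delta_{ij}$ and all other products zero, the Weyl tensor has no components of positive boost weight; (b) the Ricci tensor is $\tilde R_{ab}=\eta\,\tilde\ell_a\tilde\ell_b$. Here the boost weight of a frame component of a tensor is the number of its indices contracted with $\tilde\ell$ minus the number contracted with $\tilde n$; the boost order of the Weyl tensor along a null direction is the largest boost weight of a non-vanishing component in a null frame starting with that direction; and the (primary, genuine) Weyl type at a point is G, I, II, III or N according to whether the least boost order along null directions is $2,1,0,-1$ or $-2$, and O if the Weyl tensor vanishes there. (Type D is counted in the primary type II.) Let $n\ge 1$ and let $M=\tilde M\times\mathbb E^n$ be the direct product with flat Euclidean space, with the product metric. Let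 $\ell=(\tilde\ell,0)$ be the lift of $\tilde\ell$ to $M$. Then at every point $(p,q)\in M$: (i) If the Weyl tensor of $\tilde M$ does not vanish at $p$, then the Weyl type of $M$ at $(p,q)$ equals the Weyl type of $\tilde M$ at $p$; if it vanishes at $p$ (type O), then the Weyl type of $M$ at $(p,q)$ is N. The mWAND of $M$ at $(p,q)$ is the lift of $\tilde\ell$: a tangent vector is an mWAND of $M$ at $(p,q)$ if and only if it is a non-zero multiple of $\ell(p,q)$. (ii) The Ricci tensor of $M$ is of type N and aligned with the Weyl tensor: $R_{ab}=\eta\,\ell_a\ell_b$. (iii) For every null frame $(\tilde\ell,\tilde n,\tilde m_{(i)})$ of $\tilde M$ at $p$ and every orthonormal frame of $\mathbb E^n$, the optical matrix $\rho_{ij}=(\nabla_b\ell_a)m_{(i)}^a m_{(j)}^b$ of $\ell$ in the lifted null frame of $M$ at $(p,q)$ is $$\rho=\begin{pmatrix}\tilde\rho&0\\0&0\end{pmatrix},$$ where $\tilde\rho$ is the optical matrix of $\tilde\ell$ at $p$ in the given frame of $\tilde M$. -/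

import Mathlib

open scoped Manifold ContDiff

set_option maxSynthPendingDepth 3
set_option linter.unusedSectionVars false

noncomputable section

/-! ### Curvature of a metric given in coordinates

`G : E → E →L[ℝ] E →L[ℝ] ℝ` is a field of bilinear forms on (an open subset of) the finite
dimensional vector space `E`. -/

namespace CoordMetric

variable {E : Type*} [NormedAddCommGroup E] [NormedSpace ℝ E]

/-- The Christoffel symbols of the first kind,
`(u, v, w) ↦ (∂_u G(v, w) + ∂_v G(u, w) - ∂_w G(u, v)) / 2`. -/
def christoffelLow (G : E → E →L[ℝ] E →L[ℝ] ℝ) (y : E) : E →L[ℝ] E →L[ℝ] E →L[ℝ] ℝ :=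
  let D : E →L[ℝ] E →L[ℝ] E →L[ℝ] ℝ := fderiv ℝ G y
  let F : (E →L[ℝ] E →L[ℝ] ℝ) →L[ℝ] (E →L[ℝ] E →L[ℝ] ℝ) :=
    (ContinuousLinearMap.flipₗᵢ ℝ E E ℝ).toContinuousLinearEquiv
  (1 / 2 : ℝ) • (D + D.flip - F ∘L D.flip)

theorem christoffelLow_apply (G : E → E →L[ℝ] E →L[ℝ] ℝ) (y u v w : E) :
    christoffelLow G y u v w =
      (fderiv ℝ G y u v w + fderiv ℝ G y v u w - fderiv ℝ G y w u v) / 2 := by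
  simp [christoffelLow]
  ring

/-- The Christoffel symbols `Γ(u, v)`: the index of `christoffelLow` is raised with the inverse of
the metric `G y`, seen as a map from `E` to its dual. -/
def christoffel (G : E → E →L[ℝ] E →L[ℝ] ℝ) (y : E) : E →L[ℝ] E →L[ℝ] E :=
  (ContinuousLinearMap.compL ℝ E (E →L[ℝ] ℝ) E (G y).inverse) ∘L christoffelLow G y

theorem christoffel_apply (G : E → E →L[ℝ] E →L[ℝ] ℝ) (y u v : E) :
    christoffel G y u v = (G y).inverse (christoffelLow G y u v) := rfl

/-- The Riemann curvature operator
`R(u, v) w = ∂_u Γ(v, w) - ∂_v Γ(u, w) + Γ(u, Γ(v, w)) - Γ(v, Γ(u, w))`. -/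
def riemannOp (G : E → E →L[ℝ] E →L[ℝ] ℝ) (y u v : E) : E →L[ℝ] E :=
  fderiv ℝ (christoffel G) y u v - fderiv ℝ (christoffel G) y v u +
    christoffel G y u ∘L christoffel G y v - christoffel G y v ∘L christoffel G y u

/-- The Riemann tensor `R_{abcd} = G(a, R(c, d) b)`. -/
def riemann (G : E → E →L[ℝ] E →L[ℝ] ℝ) (y a b c d : E) : ℝ :=
  G y a (riemannOp G y c d b)

/-- The linear map `w ↦ R(w, v) u`. -/
def riemannTraceMap (G : E → E →L[ℝ] E →L[ℝ] ℝ) (y u v : E) : E →ₗ[ℝ] E where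
  toFun w := riemannOp G y w v u
  map_add' w w' := by simp [riemannOp]; abel
  map_smul' r w := by simp [riemannOp, smul_sub, smul_add]

/-- The Ricci tensor `R_{ab} = R^c_{acb}`. -/
def ricci (G : E → E →L[ℝ] E →L[ℝ] ℝ) (y : E) : E →ₗ[ℝ] E →ₗ[ℝ] ℝ :=
  LinearMap.mk₂ ℝ (fun u v => LinearMap.trace ℝ E (riemannTraceMap G y u v))
    (fun u u' v => by
      rw [← map_add]; congr 1; ext w; simp [riemannTraceMap])
    (fun r u v => by
      rw [← map_smul]; congr 1; ext w; simp [riemannTraceMap])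
    (fun u v v' => by
      rw [← map_add]; congr 1; ext w; simp [riemannTraceMap, riemannOp]; abel)
    (fun r u v => by
      rw [← map_smul]; congr 1; ext w; simp [riemannTraceMap, riemannOp, smul_sub, smul_add])

variable [FiniteDimensional ℝ E]

/-- The scalar curvature: the trace of the Ricci tensor with one index raised. -/
def scalar (G : E → E →L[ℝ] E →L[ℝ] ℝ) (y : E) : ℝ :=
  LinearMap.trace ℝ E ((G y).inverse.toLinearMap ∘ₗ
    (LinearMap.toContinuousLinearMap : (E →ₗ[ℝ] ℝ) ≃ₗ[ℝ] (E →L[ℝ] ℝ)).toLinearMap ∘ₗ ricci G y)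

/-- The Weyl tensor
`C_{abcd} = R_{abcd} - 2/(d-2) (g_{a[c} R_{d]b} - g_{b[c} R_{d]a}) + 2/((d-1)(d-2)) R g_{a[c} g_{d]b}`,
where `d` is the dimension. -/
def weyl (G : E → E →L[ℝ] E →L[ℝ] ℝ) (y a b c d : E) : ℝ :=
  riemann G y a b c d
    - 1 / ((Module.finrank ℝ E : ℝ) - 2) *
      ((G y a c * ricci G y d b - G y a d * ricci G y c b)
        - (G y b c * ricci G y d a - G y b d * ricci G y c a))
    + 1 / (((Module.finrank ℝ E : ℝ) - 1) * ((Module.finrank ℝ E : ℝ) - 2)) * scalar G y *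
      (G y a c * G y d b - G y a d * G y c b)

end CoordMetric

/-! ### Null frames and boost weights in one tangent space -/

/-- Labels of the vectors of a null frame `ℓ, n, m_i`. -/
inductive FrameIdx (ι : Type*)
  | l : FrameIdx ι
  | n : FrameIdx ι
  | m (i : ι) : FrameIdx ι

/-- The boost weight carried by one frame index: a boost maps `ℓ ↦ λ ℓ`, `n ↦ λ⁻¹ n`,
`m_i ↦ m_i`. -/
def FrameIdx.boostWeight {ι : Type*} : FrameIdx ι → ℤ
  | .l => 1
  | .n => -1
  | .m _ => 0

/-- A null frame `ℓ, n, m_i` of the vector space `V` with scalar product `B`. -/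
structure NullFrame {V : Type*} [AddCommGroup V] [Module ℝ V] (B : V → V → ℝ)
    (ι : Type*) [Fintype ι] [DecidableEq ι] where
  l : V
  n : V
  m : ι → V
  l_l : B l l = 0
  n_n : B n n = 0
  l_n : B l n = 1
  l_m : ∀ i, B l (m i) = 0
  n_m : ∀ i, B n (m i) = 0
  m_m : ∀ i j, B (m i) (m j) = if i = j then 1 else 0
  card_add_two : Fintype.card ι + 2 = Module.finrank ℝ V

/-- The frame vectors, by label. -/
def NullFrame.vec {V : Type*} [AddCommGroup V] [Module ℝ V] {B : V → V → ℝ}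
    {ι : Type*} [Fintype ι] [DecidableEq ι] (e : NullFrame B ι) : FrameIdx ι → V
  | .l => e.l
  | .n => e.n
  | .m i => e.m i

section Alignment

variable {V : Type*} [AddCommGroup V] [Module ℝ V]

/-- The boost order of the tensor `T` along the null vector `l` is at most `k`: in a null frame that
starts with `l`, all components of `T` of boost weight greater than `k` vanish. -/
def BoostOrderLE (B : V → V → ℝ) (T : V → V → V → V → ℝ) (l : V) (k : ℤ) : Prop :=
  ∃ e : NullFrame B (Fin (Module.finrank ℝ V - 2)), e.l = l ∧
    ∀ a b c d, k < a.boostWeight + b.boostWeight + c.boostWeight + d.boostWeight →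
      T (e.vec a) (e.vec b) (e.vec c) (e.vec d) = 0

/-- The primary alignment types. Type D is a secondary type, contained in the primary type II. -/
inductive AlignmentType
  | G | I | II | III | N | O

open Classical in
/-- The primary alignment type of a Weyl-like tensor `T`, determined by the least boost order of `T`
along null directions; the types are genuine, that is, mutually exclusive. -/
def alignmentType (B : V → V → ℝ) (T : V → V → V → V → ℝ) : AlignmentType :=
  if ∀ a b c d, T a b c d = 0 then .O
  else if ∃ l, BoostOrderLE B T l (-2) then .N
  else if ∃ l, BoostOrderLE B T l (-1) then .III
  else if ∃ l, BoostOrderLE B T l 0 then .II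
  else if ∃ l, BoostOrderLE B T l 1 then .I
  else .G

end Alignment

/-! ### Lorentzian manifolds -/

section Manifold

variable {E : Type*} [NormedAddCommGroup E] [NormedSpace ℝ E]
  {H : Type*} [TopologicalSpace H]

/-- A smooth Lorentzian metric of signature `(-, +, …, +)` on the manifold `M`. -/
structure LorentzMetric (I : ModelWithCorners ℝ E H) (M : Type*) [TopologicalSpace M]
    [ChartedSpace H M] [IsManifold I ∞ M] where
  /-- The scalar product on the tangent spaces. -/
  metric (x : M) : TangentSpace I x →L[ℝ] TangentSpace I x →L[ℝ] ℝ
  symm (x : M) (v w : TangentSpace I x) : metric x v w = metric x w v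
  /-- There is a timelike vector with positive definite orthogonal complement. -/
  lorentzian (x : M) : ∃ t : TangentSpace I x, metric x t t < 0 ∧
    ∀ v : TangentSpace I x, metric x t v = 0 → v ≠ 0 → 0 < metric x v v
  contMDiff : ContMDiff I (I.prod 𝓘(ℝ, E →L[ℝ] E →L[ℝ] ℝ)) ∞
    (fun x ↦ Bundle.TotalSpace.mk' (E →L[ℝ] E →L[ℝ] ℝ)
      (E := fun x : M ↦ TangentSpace I x →L[ℝ] TangentSpace I x →L[ℝ] ℝ) x (metric x))

namespace LorentzMetric

variable {I : ModelWithCorners ℝ E H} {M : Type*} [TopologicalSpace M]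
    [ChartedSpace H M] [IsManifold I ∞ M]

/-- The metric in the coordinates given by the chart at `x`. -/
def coord (g : LorentzMetric I M) (x : M) (y : E) : E →L[ℝ] E →L[ℝ] ℝ :=
  let A := mfderivWithin 𝓘(ℝ, E) I (extChartAt I x).symm (Set.range I) y
  (ContinuousLinearMap.precomp ℝ A) ∘L (g.metric ((extChartAt I x).symm y)) ∘L A

theorem coord_apply (g : LorentzMetric I M) (x : M) (y u v : E) :
    g.coord x y u v = g.metric ((extChartAt I x).symm y)
      (mfderivWithin 𝓘(ℝ, E) I (extChartAt I x).symm (Set.range I) y u)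
      (mfderivWithin 𝓘(ℝ, E) I (extChartAt I x).symm (Set.range I) y v) := rfl

/-- The coordinates of a tangent vector at `x` in the chart at `x`. -/
def toCoord (x : M) : TangentSpace I x →L[ℝ] E :=
  mfderiv I 𝓘(ℝ, E) (extChartAt I x) x

/-- The vector field `X` in the coordinates given by the chart at `x`. -/
def fieldCoord (X : ∀ x : M, TangentSpace I x) (x : M) (y : E) : E :=
  mfderiv I 𝓘(ℝ, E) (extChartAt I x) ((extChartAt I x).symm y) (X ((extChartAt I x).symm y))

/-- The Levi-Civita covariant derivative `(∇_v X)(x)`, with coordinates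
`∂_v X + Γ(v, X)` in the chart at `x`. -/
def covDeriv (g : LorentzMetric I M) (X : ∀ x : M, TangentSpace I x) (x : M)
    (v : TangentSpace I x) : TangentSpace I x :=
  mfderivWithin 𝓘(ℝ, E) I (extChartAt I x).symm (Set.range I) (extChartAt I x x)
    (fderiv ℝ (fieldCoord X x) (extChartAt I x x) (toCoord x v) +
      CoordMetric.christoffel (g.coord x) (extChartAt I x x) (toCoord x v)
        (fieldCoord X x (extChartAt I x x)))

/-- The Ricci tensor at `x`. -/
def ricci (g : LorentzMetric I M) (x : M) (u v : TangentSpace I x) : ℝ :=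
  CoordMetric.ricci (g.coord x) (extChartAt I x x) (toCoord x u) (toCoord x v)

/-- The Weyl tensor at `x`. -/
def weyl [FiniteDimensional ℝ E] (g : LorentzMetric I M) (x : M)
    (a b c d : TangentSpace I x) : ℝ :=
  CoordMetric.weyl (g.coord x) (extChartAt I x x)
    (toCoord x a) (toCoord x b) (toCoord x c) (toCoord x d)

/-- The metric at `x` as a function of two tangent vectors. -/
def form (g : LorentzMetric I M) (x : M) (u v : TangentSpace I x) : ℝ :=
  g.metric x u v

/-- The primary Weyl type at `x`. -/
def weylType [FiniteDimensional ℝ E] (g : LorentzMetric I M) (x : M) : AlignmentType :=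
  alignmentType (g.form x) (g.weyl x)

/-- `l` is a multiple Weyl aligned null direction (mWAND) at `x`: the Weyl tensor has no components
of positive boost weight with respect to the null vector `l`. -/
def IsMWAND [FiniteDimensional ℝ E] (g : LorentzMetric I M) (x : M) (l : TangentSpace I x) : Prop :=
  BoostOrderLE (g.form x) (g.weyl x) l 0

/-- The Ricci tensor at `x` is of (genuine) type N, aligned with the null vector `l`:
`R_{ab} = η l_a l_b` with `η ≠ 0`. -/
def IsRicciTypeN (g : LorentzMetric I M) (x : M) (η : ℝ) (l : TangentSpace I x) : Prop :=
  η ≠ 0 ∧ l ≠ 0 ∧ g.form x l l = 0 ∧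
    ∀ u v, g.ricci x u v = η * (g.form x l u * g.form x l v)

/-- The optical matrix `ρ_{ij} = (∇_b ℓ_a) m_i^a m_j^b` of the vector field `l` at `x`, with respect
to the spacelike vectors `m_i` of a null frame at `x`. -/
def opticalMatrix (g : LorentzMetric I M) (l : ∀ x : M, TangentSpace I x) (x : M)
    {ι : Type*} (m : ι → TangentSpace I x) : Matrix ι ι ℝ :=
  Matrix.of fun i j => g.form x (g.covDeriv l x (m j)) (m i)

end LorentzMetric

end Manifold

/-! ### The direct product with Euclidean space -/

namespace LorentzMetric

variable {E : Type*} [NormedAddCommGroup E] [NormedSpace ℝ E]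
  {H : Type*} [TopologicalSpace H] {I : ModelWithCorners ℝ E H}
  {M : Type*} [TopologicalSpace M] [ChartedSpace H M] [IsManifold I ∞ M]

/-- The differential `T_{(p, q)}(M × 𝔼ᵏ) → T_p M` of the projection. -/
def projBase {k : ℕ} (x : M × EuclideanSpace ℝ (Fin k)) :
    TangentSpace (I.prod (𝓡 k)) x →L[ℝ] TangentSpace I x.1 :=
  mfderiv (I.prod (𝓡 k)) I Prod.fst x

/-- The differential `T_{(p, q)}(M × 𝔼ᵏ) → T_q 𝔼ᵏ = 𝔼ᵏ` of the projection. -/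
def projEuclidean {k : ℕ} (x : M × EuclideanSpace ℝ (Fin k)) :
    TangentSpace (I.prod (𝓡 k)) x →L[ℝ] EuclideanSpace ℝ (Fin k) :=
  mfderiv (I.prod (𝓡 k)) (𝓡 k) Prod.snd x

/-- The lift to `T_{(p, q)}(M × 𝔼ᵏ) = T_p M × T_q 𝔼ᵏ` of a tangent vector of `M`. -/
def lift {k : ℕ} (x : M × EuclideanSpace ℝ (Fin k)) :
    TangentSpace I x.1 →L[ℝ] TangentSpace (I.prod (𝓡 k)) x :=
  ContinuousLinearMap.inl ℝ (TangentSpace I x.1) (TangentSpace (𝓡 k) x.2)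

/-- The lift to `T_{(p, q)}(M × 𝔼ᵏ) = T_p M × T_q 𝔼ᵏ` of a vector of `𝔼ᵏ`. -/
def liftEuclidean {k : ℕ} (x : M × EuclideanSpace ℝ (Fin k)) :
    EuclideanSpace ℝ (Fin k) →L[ℝ] TangentSpace (I.prod (𝓡 k)) x :=
  ContinuousLinearMap.inr ℝ (TangentSpace I x.1) (TangentSpace (𝓡 k) x.2)

theorem projBase_eq {k : ℕ} (x : M × EuclideanSpace ℝ (Fin k)) :
    (projBase x : TangentSpace (I.prod (𝓡 k)) x →L[ℝ] TangentSpace I x.1) =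
      ContinuousLinearMap.fst ℝ (TangentSpace I x.1) (TangentSpace (𝓡 k) x.2) :=
  mfderiv_fst

theorem projEuclidean_eq {k : ℕ} (x : M × EuclideanSpace ℝ (Fin k)) :
    (projEuclidean x : TangentSpace (I.prod (𝓡 k)) x →L[ℝ] EuclideanSpace ℝ (Fin k)) =
      ContinuousLinearMap.snd ℝ (TangentSpace I x.1) (TangentSpace (𝓡 k) x.2) :=
  mfderiv_snd

theorem projBase_lift {k : ℕ} (x : M × EuclideanSpace ℝ (Fin k)) (u : TangentSpace I x.1) :
    projBase x (lift x u) = u := by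
  rw [projBase_eq]; rfl

theorem projEuclidean_lift {k : ℕ} (x : M × EuclideanSpace ℝ (Fin k)) (u : TangentSpace I x.1) :
    projEuclidean x (lift x u) = 0 := by
  rw [projEuclidean_eq]; rfl

theorem projBase_liftEuclidean {k : ℕ} (x : M × EuclideanSpace ℝ (Fin k))
    (w : EuclideanSpace ℝ (Fin k)) : projBase (I := I) x (liftEuclidean x w) = 0 := by
  rw [projBase_eq]; rfl

theorem projEuclidean_liftEuclidean {k : ℕ} (x : M × EuclideanSpace ℝ (Fin k))
    (w : EuclideanSpace ℝ (Fin k)) : projEuclidean (I := I) x (liftEuclidean x w) = w := by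
  rw [projEuclidean_eq]; rfl

theorem eq_zero_of_proj {k : ℕ} (x : M × EuclideanSpace ℝ (Fin k))
    (v : TangentSpace (I.prod (𝓡 k)) x) (h₁ : projBase x v = 0) (h₂ : projEuclidean x v = 0) :
    v = 0 := by
  rw [projBase_eq] at h₁
  rw [projEuclidean_eq] at h₂
  exact Prod.ext h₁ h₂

/-- The scalar product of the direct product metric: the sum of the pullback of `g` and of the
pullback of the Euclidean metric under the two projections. -/
def prodMetric (g : LorentzMetric I M) (k : ℕ) (x : M × EuclideanSpace ℝ (Fin k)) :
    TangentSpace (I.prod (𝓡 k)) x →L[ℝ] TangentSpace (I.prod (𝓡 k)) x →L[ℝ] ℝ :=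
  (ContinuousLinearMap.precomp ℝ (projBase x)) ∘L (g.metric x.1) ∘L (projBase x) +
    (ContinuousLinearMap.precomp ℝ (projEuclidean x)) ∘L (innerSL ℝ) ∘L (projEuclidean x)

theorem prodMetric_apply (g : LorentzMetric I M) (k : ℕ) (x : M × EuclideanSpace ℝ (Fin k))
    (u v : TangentSpace (I.prod (𝓡 k)) x) :
    g.prodMetric k x u v = g.metric x.1 (projBase x u) (projBase x v) +
      inner ℝ (projEuclidean x u) (projEuclidean x v) := rfl

open Bundle ContinuousLinearMap in
theorem continuousLinearMapAt_dual (x z : M) (hz : z ∈ (chartAt H x).source)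
    (φ : TangentSpace I z →L[ℝ] ℝ) (u : E) :
    (Trivialization.continuousLinearMapAt ℝ
      (trivializationAt (E →L[ℝ] ℝ) (fun x : M => TangentSpace I x →L[ℝ] ℝ) x) z φ) u =
      φ (Trivialization.symmL ℝ (trivializationAt E (TangentSpace I) x) z u) := by
  have hz' : z ∈ (trivializationAt (E →L[ℝ] ℝ)
      (fun x : M => TangentSpace I x →L[ℝ] ℝ) x).baseSet := by
    rw [hom_trivializationAt_baseSet]
    simp [hz]
  rw [Trivialization.continuousLinearMapAt_apply, Trivialization.linearMapAt_apply, if_pos hz',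
    hom_trivializationAt_apply]
  simp [inCoordinates]

theorem proj_symmL (k : ℕ) (x z : M × EuclideanSpace ℝ (Fin k))
    (hz : z.1 ∈ (chartAt H x.1).source) (u : E × EuclideanSpace ℝ (Fin k)) :
    projBase z (Bundle.Trivialization.symmL ℝ (trivializationAt (E × EuclideanSpace ℝ (Fin k))
      (TangentSpace (I.prod (𝓡 k))) x) z u) =
      Bundle.Trivialization.symmL ℝ (trivializationAt E (TangentSpace I) x.1) z.1 u.1 ∧
    projEuclidean z (Bundle.Trivialization.symmL ℝ (trivializationAt (E × EuclideanSpace ℝ (Fin k))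
      (TangentSpace (I.prod (𝓡 k))) x) z u) = u.2 := by
  have hz' : z ∈ (chartAt (ModelProd H (EuclideanSpace ℝ (Fin k))) x).source :=
    ⟨hz, Set.mem_univ _⟩
  rw [TangentBundle.symmL_trivializationAt hz', TangentBundle.symmL_trivializationAt hz]
  have hr : Set.range (I.prod (𝓡 k)) = Set.range I ×ˢ Set.univ := by
    rw [modelWithCorners_prod_coe, Set.range_prodMap, modelWithCornersSelf_coe, Set.range_id]
  have hs : ((extChartAt (I.prod (𝓡 k)) x).symm : E × EuclideanSpace ℝ (Fin k) → M × EuclideanSpace ℝ (Fin k)) =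
      Prod.map (extChartAt I x.1).symm id := by
    rw [extChartAt_prod]
    rfl
  have ht : extChartAt (I.prod (𝓡 k)) x z = (extChartAt I x.1 z.1, z.2) := by
    rw [extChartAt_prod]
    rfl
  have hd : MDifferentiableWithinAt 𝓘(ℝ, E) I (extChartAt I x.1).symm (Set.range I)
      (extChartAt I x.1 z.1) :=
    mdifferentiableWithinAt_extChartAt_symm ((extChartAt I x.1).map_source (by simpa using hz))
  have hm := mfderivWithin_prodMap (p := (extChartAt I x.1 z.1, z.2)) (t := Set.univ)
    (g := (id : EuclideanSpace ℝ (Fin k) → EuclideanSpace ℝ (Fin k))) (I' := 𝓡 k) (J' := 𝓡 k) hd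
    mdifferentiableWithinAt_id (I.uniqueMDiffOn _ ⟨_, rfl⟩) (uniqueMDiffWithinAt_univ _)
  rw [← modelWithCornersSelf_prod, chartedSpaceSelf_prod] at hm
  rw [projBase_eq, projEuclidean_eq, hs, ht, hr]
  have hu := DFunLike.congr_fun hm u
  refine ⟨congrArg (Prod.fst : E × EuclideanSpace ℝ (Fin k) → E) hu,
    (congrArg (Prod.snd : E × EuclideanSpace ℝ (Fin k) → EuclideanSpace ℝ (Fin k)) hu).trans ?_⟩
  exact DFunLike.congr_fun
    (mfderivWithin_id (I := 𝓡 k) (x := z.2) (uniqueMDiffWithinAt_univ (𝓡 k))) u.2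

open Bundle ContinuousLinearMap in
theorem prodMetric_contMDiff (g : LorentzMetric I M) (k : ℕ) :
    ContMDiff (I.prod (𝓡 k)) ((I.prod (𝓡 k)).prod
      𝓘(ℝ, (E × EuclideanSpace ℝ (Fin k)) →L[ℝ] (E × EuclideanSpace ℝ (Fin k)) →L[ℝ] ℝ)) ∞
    (fun x ↦ Bundle.TotalSpace.mk' ((E × EuclideanSpace ℝ (Fin k)) →L[ℝ] (E × EuclideanSpace ℝ (Fin k)) →L[ℝ] ℝ)
      (E := fun x : M × EuclideanSpace ℝ (Fin k) ↦
        TangentSpace (I.prod (𝓡 k)) x →L[ℝ] TangentSpace (I.prod (𝓡 k)) x →L[ℝ] ℝ)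
      x (g.prodMetric k x)) := by
  intro x
  have h := g.contMDiff x.1
  rw [contMDiffAt_section] at h ⊢
  simp only [hom_trivializationAt_apply, inCoordinates] at h ⊢
  have h1 := h.comp x (contMDiffAt_fst (I := I) (J := 𝓡 k) (n := ∞))
  let P := ContinuousLinearMap.fst ℝ E (EuclideanSpace ℝ (Fin k))
  let Q := ContinuousLinearMap.snd ℝ E (EuclideanSpace ℝ (Fin k))
  let Φ : (E →L[ℝ] E →L[ℝ] ℝ) → ((E × EuclideanSpace ℝ (Fin k)) →L[ℝ] (E × EuclideanSpace ℝ (Fin k)) →L[ℝ] ℝ) :=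
    fun N => (ContinuousLinearMap.compL ℝ _ _ _).flip P ∘L N ∘L P +
      (ContinuousLinearMap.compL ℝ _ _ _).flip Q ∘L (innerSL ℝ) ∘L Q
  have hΦ : ContDiff ℝ ∞ Φ := by fun_prop
  have h2 := (hΦ.contMDiff.contMDiffAt).comp x h1
  refine h2.congr_of_eventuallyEq ?_
  have ho : (chartAt H x.1).source ×ˢ (Set.univ : Set (EuclideanSpace ℝ (Fin k))) ∈ nhds x :=
    prod_mem_nhds (chart_source_mem_nhds H x.1) Filter.univ_mem
  filter_upwards [ho] with z hz
  have hz1 : z.1 ∈ (chartAt H x.1).source := hz.1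
  have hz' : z ∈ (chartAt (ModelProd H (EuclideanSpace ℝ (Fin k))) x).source :=
    ⟨hz1, Set.mem_univ _⟩
  refine ContinuousLinearMap.ext fun u => ContinuousLinearMap.ext fun v => ?_
  rw [ContinuousLinearMap.comp_apply, continuousLinearMapAt_dual _ _ hz',
    ContinuousLinearMap.comp_apply, prodMetric_apply, (proj_symmL k x z hz1 u).1,
    (proj_symmL k x z hz1 u).2, (proj_symmL k x z hz1 v).1, (proj_symmL k x z hz1 v).2]
  exact congrArg₂ (· + ·) (continuousLinearMapAt_dual _ _ hz1 _ _).symm rfl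

/-- The direct product of the spacetime `(M, g)` with the flat Euclidean space `𝔼ᵏ`. -/
def prodEuclidean (g : LorentzMetric I M) (k : ℕ) :
    LorentzMetric (I.prod (𝓡 k)) (M × EuclideanSpace ℝ (Fin k)) where
  metric x := g.prodMetric k x
  symm x u v := by
    rw [prodMetric_apply, prodMetric_apply, g.symm, real_inner_comm]
  lorentzian x := by
    obtain ⟨t, ht, hp⟩ := g.lorentzian x.1
    refine ⟨lift x t, ?_, fun v hv hv0 => ?_⟩
    · simpa [prodMetric_apply, projBase_lift, projEuclidean_lift] using ht
    · have hv1 : g.metric x.1 t (projBase x v) = 0 := by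
        simpa [prodMetric_apply, projBase_lift, projEuclidean_lift] using hv
      rw [prodMetric_apply]
      by_cases hz : projBase x v = 0
      · have hz2 : projEuclidean x v ≠ 0 := fun h => hv0 (eq_zero_of_proj x v hz h)
        rw [hz, map_zero, zero_add]
        exact real_inner_self_pos.2 hz2
      · exact add_pos_of_pos_of_nonneg (hp _ hv1 hz) real_inner_self_nonneg
  contMDiff := g.prodMetric_contMDiff k

/-- The lift to `M × 𝔼ᵏ` of a vector field on `M`. -/
def liftField (k : ℕ) (l : ∀ p : M, TangentSpace I p) (x : M × EuclideanSpace ℝ (Fin k)) :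
    TangentSpace (I.prod (𝓡 k)) x :=
  lift x (l x.1)

theorem form_prodEuclidean (g : LorentzMetric I M) {k : ℕ} (x : M × EuclideanSpace ℝ (Fin k))
    (u v : TangentSpace (I.prod (𝓡 k)) x) :
    (g.prodEuclidean k).form x u v = g.form x.1 (projBase x u) (projBase x v) +
      inner ℝ (projEuclidean x u) (projEuclidean x v) := rfl

theorem form_lift_lift (g : LorentzMetric I M) {k : ℕ} (x : M × EuclideanSpace ℝ (Fin k))
    (u v : TangentSpace I x.1) :
    (g.prodEuclidean k).form x (lift x u) (lift x v) = g.form x.1 u v := by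
  simp [form_prodEuclidean, projBase_lift, projEuclidean_lift]

theorem form_lift_liftEuclidean (g : LorentzMetric I M) {k : ℕ} (x : M × EuclideanSpace ℝ (Fin k))
    (u : TangentSpace I x.1) (w : EuclideanSpace ℝ (Fin k)) :
    (g.prodEuclidean k).form x (lift x u) (liftEuclidean x w) = 0 := by
  rw [form_prodEuclidean]
  simp [projEuclidean_lift, projBase_liftEuclidean, form]

theorem form_liftEuclidean_liftEuclidean (g : LorentzMetric I M) {k : ℕ}
    (x : M × EuclideanSpace ℝ (Fin k)) (w w' : EuclideanSpace ℝ (Fin k)) :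
    (g.prodEuclidean k).form x (liftEuclidean x w) (liftEuclidean x w') = inner ℝ w w' := by
  rw [form_prodEuclidean]
  simp [projBase_liftEuclidean, projEuclidean_liftEuclidean, form]

/-- The null frame of the product obtained by lifting a null frame of `M` and an orthonormal
frame of Euclidean space. -/
def liftFrame [FiniteDimensional ℝ E] (g : LorentzMetric I M) {k : ℕ} (x : M × EuclideanSpace ℝ (Fin k))
    {ι κ : Type*} [Fintype ι] [DecidableEq ι] [Fintype κ] [DecidableEq κ]
    (e : NullFrame (g.form x.1) ι) (f : OrthonormalBasis κ ℝ (EuclideanSpace ℝ (Fin k))) :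
    NullFrame ((g.prodEuclidean k).form x) (ι ⊕ κ) where
  l := lift x e.l
  n := lift x e.n
  m := Sum.elim (fun i => lift x (e.m i)) (fun j => liftEuclidean x (f j))
  l_l := (g.form_lift_lift x _ _).trans e.l_l
  n_n := (g.form_lift_lift x _ _).trans e.n_n
  l_n := (g.form_lift_lift x _ _).trans e.l_n
  l_m := by
    rintro (i | j)
    · exact (g.form_lift_lift x _ _).trans (e.l_m i)
    · exact g.form_lift_liftEuclidean x _ _
  n_m := by
    rintro (i | j)
    · exact (g.form_lift_lift x _ _).trans (e.n_m i)
    · exact g.form_lift_liftEuclidean x _ _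
  m_m := by
    rintro (i | i) (j | j)
    · exact (g.form_lift_lift x _ _).trans ((e.m_m i j).trans (by simp))
    · exact (g.form_lift_liftEuclidean x _ _).trans (by simp)
    · exact ((g.prodEuclidean k).symm x _ _).trans
        ((g.form_lift_liftEuclidean x _ _).trans (by simp))
    · exact (g.form_liftEuclidean_liftEuclidean x _ _).trans
        ((f.inner_eq_ite i j).trans (by simp))
  card_add_two := by
    have h1 : Fintype.card ι + 2 = Module.finrank ℝ E := e.card_add_two
    have h2 : Module.finrank ℝ (EuclideanSpace ℝ (Fin k)) = Fintype.card κ :=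
      Module.finrank_eq_card_basis f.toBasis
    have h3 : Module.finrank ℝ (E × EuclideanSpace ℝ (Fin k)) = Fintype.card (ι ⊕ κ) + 2 := by
      rw [Module.finrank_prod, h2, ← h1, Fintype.card_sum]
      omega
    exact h3.symm

end LorentzMetric

end

/-! In a product chart the metric of the product is the orthogonal sum of the base metric and a
constant one, so its Christoffel symbols, Riemann tensor and Ricci tensor are pulled back from the
base. This gives (ii). It also shows that the covariant derivative of the lifted field is the lift
of the base derivative along the projected direction, which gives (iii).

For (i), both scalar curvatures vanish because `l` is null. Hence in each dimension `d` the Weyl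
tensor is the Riemann tensor minus `η/(d-2)` times the Kulkarni–Nomizu type product `N` of the
metric with `l ⊗ l`. Eliminating the common Riemann tensor yields `C' = C + α N - β N'` with `β =
η/(m+n-2) ≠ 0` (`IsProdOn.weyl_eq`). The rest is linear algebra (`alignment_lift`). Boost order is
expressed by the flag of `l`, so that lifting and changing frames are easy.

Since `N` and `N'` have boost order at most `-2` along `l`, `C'` and `C` satisfy the same bounds `k
≥ -2` along `l`. It remains to see that no other null direction matters. In the base, a second null
direction of negative boost order would force `C = 0` (`eq_zero_of_vanishesAbove`). In the product,
inserting a Euclidean vector in the last slot isolates the term `β N'`. It forces every mWAND to be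
orthogonal to `l` (`inner_null_eq_zero_of_vanishesAbove`), hence parallel to it. The same term keeps
`C'` non-zero when `C = 0`, and this is the jump from type O to type N. -/

noncomputable section

/-! ### Tensors of rank four and the flag of a null vector -/

section BoostFlag

variable {V : Type*} [AddCommGroup V] [Module ℝ V]

/-- `T` is linear in each of its four arguments. -/
structure IsMultilinear₄ (T : V → V → V → V → ℝ) : Prop where
  fst : ∀ b c d, IsLinearMap ℝ fun a => T a b c d
  snd : ∀ a c d, IsLinearMap ℝ fun b => T a b c d
  trd : ∀ a b d, IsLinearMap ℝ fun c => T a b c d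
  fth : ∀ a b c, IsLinearMap ℝ fun d => T a b c d

theorem IsLinearMap.eq_zero_of_mem_span {f : V → ℝ} (hf : IsLinearMap ℝ f) {s : Set V}
    (h : ∀ a ∈ s, f a = 0) {a : V} (ha : a ∈ Submodule.span ℝ s) : f a = 0 :=
  (Submodule.span_le (p := LinearMap.ker (hf.mk' f))).2 (fun x hx => h x hx) ha

theorem IsMultilinear₄.eq_zero_of_mem_span {T : V → V → V → V → ℝ} (hT : IsMultilinear₄ T)
    {s₁ s₂ s₃ s₄ : Set V}
    (h : ∀ a ∈ s₁, ∀ b ∈ s₂, ∀ c ∈ s₃, ∀ d ∈ s₄, T a b c d = 0) {a b c d : V}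
    (ha : a ∈ Submodule.span ℝ s₁) (hb : b ∈ Submodule.span ℝ s₂)
    (hc : c ∈ Submodule.span ℝ s₃) (hd : d ∈ Submodule.span ℝ s₄) : T a b c d = 0 :=
  (hT.fst b c d).eq_zero_of_mem_span (fun _ ha' =>
    (hT.snd _ c d).eq_zero_of_mem_span (fun _ hb' =>
      (hT.trd _ _ d).eq_zero_of_mem_span (fun _ hc' =>
        (hT.fth _ _ _).eq_zero_of_mem_span (fun _ hd' => h _ ha' _ hb' _ hc' _ hd') hd) hc) hb) ha

/-- The flag `V ⊇ l^⊥ ⊇ ℝ l ⊇ 0` of a null vector `l`, indexed by boost weight. -/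
def boostFlag (B : V →ₗ[ℝ] V →ₗ[ℝ] ℝ) (l : V) (w : ℤ) : Submodule ℝ V :=
  if w ≤ -1 then ⊤ else if w ≤ 0 then LinearMap.ker (B l)
  else if w ≤ 1 then Submodule.span ℝ {l} else ⊥

/-- All components of `T` of boost weight greater than `k` with respect to the null vector `l`
vanish; this is expressed by the flag of `l`, without reference to a frame. -/
def VanishesAbove (B : V →ₗ[ℝ] V →ₗ[ℝ] ℝ) (T : V → V → V → V → ℝ) (l : V) (k : ℤ) : Prop :=
  ∀ w₁ w₂ w₃ w₄ : ℤ, k < w₁ + w₂ + w₃ + w₄ → ∀ a ∈ boostFlag B l w₁, ∀ b ∈ boostFlag B l w₂,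
    ∀ c ∈ boostFlag B l w₃, ∀ d ∈ boostFlag B l w₄, T a b c d = 0

variable {B : V →ₗ[ℝ] V →ₗ[ℝ] ℝ}

theorem mem_boostFlag_of_le_neg_one {l a : V} {w : ℤ} (hw : w ≤ -1) : a ∈ boostFlag B l w := by
  simp [boostFlag, hw]

theorem mem_boostFlag_zero {l a : V} : a ∈ boostFlag B l 0 ↔ B l a = 0 := by
  simp [boostFlag]

theorem self_mem_boostFlag_one (l : V) : l ∈ boostFlag B l 1 := by
  simp [boostFlag, Submodule.mem_span_singleton_self]

theorem boostFlag_smul {l : V} {r : ℝ} (hr : r ≠ 0) (w : ℤ) :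
    boostFlag B (r • l) w = boostFlag B l w := by
  unfold boostFlag
  split_ifs
  · rfl
  · rw [map_smul, LinearMap.ker_smul _ _ hr]
  · exact Submodule.span_singleton_smul_eq (IsUnit.mk0 r hr) l
  · rfl

theorem VanishesAbove.smul_iff {T : V → V → V → V → ℝ} {l : V} {r : ℝ} (hr : r ≠ 0) {k : ℤ} :
    VanishesAbove B T (r • l) k ↔ VanishesAbove B T l k := by
  simp only [VanishesAbove, boostFlag_smul hr]

theorem boostFlag_cases {l a : V} {w : ℤ} (ha : a ∈ boostFlag B l w) :
    w ≤ -1 ∨ (w = 0 ∧ B l a = 0) ∨ (w = 1 ∧ ∃ r : ℝ, r • l = a) ∨ a = 0 := by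
  unfold boostFlag at ha
  split_ifs at ha with h₁ h₂ h₃
  · exact .inl h₁
  · exact .inr (.inl ⟨by omega, ha⟩)
  · exact .inr (.inr (.inl ⟨by omega, Submodule.mem_span_singleton.1 ha⟩))
  · exact .inr (.inr (.inr ha))

/-- Vectors of the flag whose boost weights have a positive sum are orthogonal. -/
theorem eq_zero_of_mem_boostFlag (hB : ∀ u v, B u v = B v u) {l : V} (hl : B l l = 0) {a b : V}
    {w w' : ℤ} (h : 0 < w + w') (ha : a ∈ boostFlag B l w) (hb : b ∈ boostFlag B l w') :
    B a b = 0 := by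
  rcases boostFlag_cases ha with h₁ | ⟨rfl, h₁⟩ | ⟨rfl, r, rfl⟩ | rfl <;>
  rcases boostFlag_cases hb with h₂ | ⟨rfl, h₂⟩ | ⟨rfl, s, rfl⟩ | rfl <;>
  first
  | omega
  | simp_all

theorem inner_null_eq_zero_of_mem_boostFlag {l : V} (hl : B l l = 0) {a : V} {w : ℤ}
    (h : -1 < w) (ha : a ∈ boostFlag B l w) : B l a = 0 := by
  rcases boostFlag_cases ha with h₁ | ⟨rfl, h₁⟩ | ⟨rfl, r, rfl⟩ | rfl
  · omega
  · exact h₁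
  · simp [hl]
  · simp

/-- The Kulkarni–Nomizu type product of `B` with `l_a l_b`. -/
def nullKN (B : V →ₗ[ℝ] V →ₗ[ℝ] ℝ) (l a b c d : V) : ℝ :=
  (B a c * (B l d * B l b) - B a d * (B l c * B l b))
    - (B b c * (B l d * B l a) - B b d * (B l c * B l a))

theorem nullKN_isMultilinear₄ (B : V →ₗ[ℝ] V →ₗ[ℝ] ℝ) (l : V) : IsMultilinear₄ (nullKN B l) := by
  constructor <;> intros <;> constructor <;> intros <;> simp [nullKN] <;> ring

/-- Each term has the shape `B a b * (B l c * B l d)`. It can be non-zero only if `c` and `d` have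
weight at most `-1`. A total weight above `-2` then leaves `a` and `b` with positive weight sum, so
they are orthogonal. -/
theorem nullKN_vanishesAbove (hB : ∀ u v, B u v = B v u) {l : V} (hl : B l l = 0) {k : ℤ}
    (hk : -2 ≤ k) : VanishesAbove B (nullKN B l) l k := by
  have key : ∀ w₁ w₂ w₃ w₄ : ℤ, -2 < w₁ + w₂ + w₃ + w₄ → ∀ a ∈ boostFlag B l w₁,
      ∀ b ∈ boostFlag B l w₂, ∀ c ∈ boostFlag B l w₃, ∀ d ∈ boostFlag B l w₄,
      B a b * (B l c * B l d) = 0 := by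
    intro w₁ w₂ w₃ w₄ h a ha b hb c hc d hd
    by_cases h₃ : -1 < w₃
    · simp [inner_null_eq_zero_of_mem_boostFlag hl h₃ hc]
    by_cases h₄ : -1 < w₄
    · simp [inner_null_eq_zero_of_mem_boostFlag hl h₄ hd]
    · simp [eq_zero_of_mem_boostFlag hB hl (by omega) ha hb]
  intro w₁ w₂ w₃ w₄ h a ha b hb c hc d hd
  rw [nullKN, key w₁ w₃ w₄ w₂ (by omega) a ha c hc d hd b hb,
    key w₁ w₄ w₃ w₂ (by omega) a ha d hd c hc b hb,
    key w₂ w₃ w₄ w₁ (by omega) b hb c hc d hd a ha,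
    key w₂ w₄ w₃ w₁ (by omega) b hb d hd c hc a ha]
  simp

/-- A tensor that has boost order at most `0` along a null vector `l` and at most `-1` along a null
vector that is not orthogonal to `l` vanishes. -/
theorem eq_zero_of_vanishesAbove (hB : ∀ u v, B u v = B v u) {T : V → V → V → V → ℝ}
    (hT : IsMultilinear₄ T) {l l' : V} (hl : B l l = 0) (hl' : B l' l' = 0) (hs : B l l' ≠ 0)
    (h : VanishesAbove B T l 0) (h' : VanishesAbove B T l' (-1)) (a b c d : V) : T a b c d = 0 := by
  -- Opposite null vectors carry opposite weights: `l` has weights `(1, -1)`, `l'` has `(-1, 1)`,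
  -- and vectors orthogonal to both have `(0, 0)`. Such vectors span.
  let s : Set V := {v | ∃ w : ℤ, v ∈ boostFlag B l w ∧ v ∈ boostFlag B l' (-w)}
  have hs' : B l' l ≠ 0 := by rwa [hB]
  have hl_mem : l ∈ s := ⟨1, self_mem_boostFlag_one l, mem_boostFlag_of_le_neg_one le_rfl⟩
  have hl'_mem : l' ∈ s := ⟨-1, mem_boostFlag_of_le_neg_one le_rfl, by
    simpa using self_mem_boostFlag_one l'⟩
  have hspan (v : V) : v ∈ Submodule.span ℝ s := by
    have hv : v - (B l' v / B l' l) • l - (B l v / B l l') • l' ∈ s := by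
      refine ⟨0, mem_boostFlag_zero.2 ?_, ?_⟩
      · simp [hl, hs]
      · rw [neg_zero, mem_boostFlag_zero]
        simp [hl', hs']
    have := Submodule.add_mem _ (Submodule.add_mem _ (Submodule.subset_span hv)
      (Submodule.smul_mem _ (B l v / B l l') (Submodule.subset_span hl'_mem)))
      (Submodule.smul_mem _ (B l' v / B l' l) (Submodule.subset_span hl_mem))
    simpa using this
  refine hT.eq_zero_of_mem_span (s₁ := s) (s₂ := s) (s₃ := s) (s₄ := s) ?_
    (hspan a) (hspan b) (hspan c) (hspan d)
  rintro a ⟨w₁, ha, ha'⟩ b ⟨w₂, hb, hb'⟩ c ⟨w₃, hc, hc'⟩ d ⟨w₄, hd, hd'⟩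
  -- Either the total weight along `l` is positive, or the total weight along `l'` is at least `0 >
  -- -1`.
  by_cases hw : 0 < w₁ + w₂ + w₃ + w₄
  · exact h _ _ _ _ hw a ha b hb c hc d hd
  · exact h' _ _ _ _ (by omega) a ha' b hb' c hc' d hd'

end BoostFlag

/-! ### Null frames -/

namespace NullFrame

variable {V : Type*} [AddCommGroup V] [Module ℝ V] {B : V →ₗ[ℝ] V →ₗ[ℝ] ℝ}
  {ι : Type*} [Fintype ι] [DecidableEq ι]

/-- The null frame with relabelled spacelike vectors. -/
def reindex {B : V → V → ℝ} {κ : Type*} [Fintype κ] [DecidableEq κ] (e : NullFrame B ι)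
    (σ : κ ≃ ι) : NullFrame B κ where
  l := e.l
  n := e.n
  m := e.m ∘ σ
  l_l := e.l_l
  n_n := e.n_n
  l_n := e.l_n
  l_m i := e.l_m _
  n_m i := e.n_m _
  m_m i j := by simp [e.m_m]
  card_add_two := by rw [Fintype.card_congr σ]; exact e.card_add_two

/-- The boosted null frame `r l, r⁻¹ n, m_i`. -/
def boost (e : NullFrame (fun u v => B u v) ι) {r : ℝ} (hr : r ≠ 0) :
    NullFrame (fun u v => B u v) ι where
  l := r • e.l
  n := r⁻¹ • e.n
  m := e.m
  l_l := by simp [e.l_l]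
  n_n := by simp [e.n_n]
  l_n := by simp [e.l_n, hr]
  l_m i := by simp [e.l_m]
  n_m i := by simp [e.n_m]
  m_m := e.m_m
  card_add_two := e.card_add_two

theorem exists_eq (hB : ∀ u v, B u v = B v u) (e : NullFrame (fun u v => B u v) ι) (v : V) :
    v = B e.n v • e.l + B e.l v • e.n + ∑ i, B (e.m i) v • e.m i := by
  have hpos : 0 < Module.finrank ℝ V := by rw [← e.card_add_two]; omega
  -- A positive `finrank` already excludes the default value `0` of infinite dimension.
  have : FiniteDimensional ℝ V := Module.finite_of_finrank_pos hpos
  have hll := e.l_l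
  have hnn := e.n_n
  have hln := e.l_n
  have hnl : B e.n e.l = 1 := by rw [hB]; exact e.l_n
  have hlm := e.l_m
  have hnm := e.n_m
  have hml (i) : B (e.m i) e.l = 0 := by rw [hB]; exact e.l_m i
  have hmn (i) : B (e.m i) e.n = 0 := by rw [hB]; exact e.n_m i
  have hmm := e.m_m
  beta_reduce at hll hnn hln hlm hnm hmm
  let φ : V →ₗ[ℝ] ℝ × ℝ × (ι → ℝ) :=
    (B e.n).prod ((B e.l).prod (LinearMap.pi fun i => B (e.m i)))
  let ψ : ℝ × ℝ × (ι → ℝ) →ₗ[ℝ] V :=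
    (LinearMap.toSpanSingleton ℝ V e.l).coprod ((LinearMap.toSpanSingleton ℝ V e.n).coprod
      (Fintype.linearCombination ℝ e.m))
  have hφψ : φ ∘ₗ ψ = LinearMap.id := by
    refine LinearMap.ext fun ⟨x, y, z⟩ => ?_
    refine Prod.ext ?_ (Prod.ext ?_ (funext fun i => ?_))
    · simp [φ, ψ, hnl, hnn, hnm, Fintype.linearCombination_apply]
    · simp [φ, ψ, hll, hln, hlm, Fintype.linearCombination_apply]
    · simp [φ, ψ, hml, hmn, hmm, Fintype.linearCombination_apply]
  have hdim : Module.finrank ℝ V = Module.finrank ℝ (ℝ × ℝ × (ι → ℝ)) := by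
    rw [← e.card_add_two]
    simp
    omega
  have hsurj : Function.Surjective φ := fun y => ⟨ψ y, LinearMap.congr_fun hφψ y⟩
  have hinj : Function.Injective φ :=
    (LinearMap.injective_iff_surjective_of_finrank_eq_finrank hdim).2 hsurj
  -- By the dimension count `φ` is injective, so its right inverse `ψ` is also a left inverse.
  have : ψ (φ v) = v := hinj (LinearMap.congr_fun hφψ (φ v))
  refine this.symm.trans ?_
  simp [ψ, φ, Fintype.linearCombination_apply, add_assoc]

theorem l_ne_zero (e : NullFrame (fun u v => B u v) ι) : e.l ≠ 0 := fun h => by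
  have := e.l_n
  simp [h] at this

theorem vec_mem_boostFlag (e : NullFrame (fun u v => B u v) ι) (a : FrameIdx ι) :
    e.vec a ∈ boostFlag B e.l a.boostWeight := by
  cases a with
  | l => exact self_mem_boostFlag_one _
  | n => exact mem_boostFlag_of_le_neg_one le_rfl
  | m i => exact mem_boostFlag_zero.2 (e.l_m i)

theorem boostFlag_le_span (hB : ∀ u v, B u v = B v u) (e : NullFrame (fun u v => B u v) ι)
    (w : ℤ) {v : V} (hv : v ∈ boostFlag B e.l w) :
    v ∈ Submodule.span ℝ {u | ∃ a : FrameIdx ι, w ≤ a.boostWeight ∧ u = e.vec a} := by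
  have hmem (a : FrameIdx ι) (ha : w ≤ a.boostWeight) (r : ℝ) : r • e.vec a ∈
      Submodule.span ℝ {u | ∃ a : FrameIdx ι, w ≤ a.boostWeight ∧ u = e.vec a} :=
    Submodule.smul_mem _ _ (Submodule.subset_span ⟨a, ha, rfl⟩)
  rcases boostFlag_cases hv with h | ⟨rfl, h⟩ | ⟨rfl, r, rfl⟩ | rfl
  · rw [e.exists_eq hB v]
    exact add_mem (add_mem (hmem .l (h.trans neg_one_lt_zero.le |>.trans zero_le_one) _) (hmem .n h _))
      (sum_mem fun i _ => hmem (.m i) (h.trans neg_one_lt_zero.le) _)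
  · rw [e.exists_eq hB v, h, zero_smul, add_zero]
    exact add_mem (hmem .l zero_le_one _) (sum_mem fun i _ => hmem (.m i) le_rfl _)
  · exact hmem .l le_rfl r
  · exact zero_mem _

/-- The frame vectors of weight at least `w` span the step `w` of the flag. The left side does not
mention the rest of the frame, so the boost order depends on `l` alone. -/
theorem vanishesAbove_iff (hB : ∀ u v, B u v = B v u) {T : V → V → V → V → ℝ}
    (hT : IsMultilinear₄ T) (e : NullFrame (fun u v => B u v) ι) {k : ℤ} :
    VanishesAbove B T e.l k ↔ ∀ a b c d : FrameIdx ι,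
      k < a.boostWeight + b.boostWeight + c.boostWeight + d.boostWeight →
        T (e.vec a) (e.vec b) (e.vec c) (e.vec d) = 0 := by
  refine ⟨fun h a b c d hk => h _ _ _ _ hk _ (e.vec_mem_boostFlag a) _ (e.vec_mem_boostFlag b) _
    (e.vec_mem_boostFlag c) _ (e.vec_mem_boostFlag d), fun h w₁ w₂ w₃ w₄ hk a ha b hb c hc d hd => ?_⟩
  refine hT.eq_zero_of_mem_span ?_ (e.boostFlag_le_span hB _ ha) (e.boostFlag_le_span hB _ hb)
    (e.boostFlag_le_span hB _ hc) (e.boostFlag_le_span hB _ hd)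
  rintro _ ⟨a, ha, rfl⟩ _ ⟨b, hb, rfl⟩ _ ⟨c, hc, rfl⟩ _ ⟨d, hd, rfl⟩
  exact h a b c d (by omega)

/-- A null vector orthogonal to the first vector of a null frame is a multiple of it. -/
theorem exists_smul_eq (hB : ∀ u v, B u v = B v u) (e : NullFrame (fun u v => B u v) ι) {v : V}
    (hv : B v v = 0) (hlv : B e.l v = 0) : ∃ r : ℝ, v = r • e.l := by
  have h := e.exists_eq hB v
  rw [hlv, zero_smul, add_zero] at h
  -- Pairing the expansion of `v` with `v` itself leaves only the squares of the spacelike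
  -- components.
  have hsum : ∑ i, B (e.m i) v * B (e.m i) v = 0 := by
    have h' := congrArg (B v) h
    rw [hv, map_add, map_smul, hB v e.l, hlv, smul_zero, zero_add, map_sum] at h'
    rw [h']
    exact Finset.sum_congr rfl fun i _ => by rw [map_smul, hB v, smul_eq_mul]
  have h0 := (Finset.sum_eq_zero_iff_of_nonneg fun i _ => mul_self_nonneg (B (e.m i) v)).1 hsum
  refine ⟨B e.n v, h.trans ?_⟩
  rw [Finset.sum_eq_zero fun i hi => by rw [mul_self_eq_zero.1 (h0 i hi), zero_smul], add_zero]

end NullFrame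

/-! ### Boost order along null directions and the primary alignment type -/

section BoostOrder

variable {V : Type*} [AddCommGroup V] [Module ℝ V] {B : V →ₗ[ℝ] V →ₗ[ℝ] ℝ}

theorem BoostOrderLE.vanishesAbove (hB : ∀ u v, B u v = B v u) {T : V → V → V → V → ℝ}
    (hT : IsMultilinear₄ T) {l : V} {k : ℤ} (h : BoostOrderLE (fun u v => B u v) T l k) :
    VanishesAbove B T l k := by
  obtain ⟨e, rfl, he⟩ := h
  exact (e.vanishesAbove_iff hB hT).2 he

theorem BoostOrderLE.mono {B : V → V → ℝ} {T : V → V → V → V → ℝ} {l : V} {k k' : ℤ}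
    (hk : k ≤ k') (h : BoostOrderLE B T l k) : BoostOrderLE B T l k' := by
  obtain ⟨e, rfl, he⟩ := h
  exact ⟨e, rfl, fun a b c d hw => he a b c d (hk.trans_lt hw)⟩

theorem BoostOrderLE.null {T : V → V → V → V → ℝ} {l : V} {k : ℤ}
    (h : BoostOrderLE (fun u v => B u v) T l k) : B l l = 0 ∧ l ≠ 0 := by
  obtain ⟨e, rfl, -⟩ := h
  exact ⟨e.l_l, e.l_ne_zero⟩

theorem NullFrame.boostOrderLE (hB : ∀ u v, B u v = B v u) {T : V → V → V → V → ℝ}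
    (hT : IsMultilinear₄ T) {ι : Type*} [Fintype ι] [DecidableEq ι]
    (e : NullFrame (fun u v => B u v) ι) {k : ℤ} (h : VanishesAbove B T e.l k) :
    BoostOrderLE (fun u v => B u v) T e.l k := by
  have hc : Fintype.card (Fin (Module.finrank ℝ V - 2)) = Fintype.card ι := by
    rw [Fintype.card_fin, ← e.card_add_two, Nat.add_sub_cancel]
  let e' := e.reindex (Fintype.equivOfCardEq hc)
  exact ⟨e', rfl, (e'.vanishesAbove_iff hB hT).1 h⟩

open Classical in
/-- The alignment type of a tensor of boost order at most `0` along `l`, when all null vectors along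
which it has negative boost order are multiples of `l`. -/
theorem alignmentType_eq (hB : ∀ u v, B u v = B v u) {T : V → V → V → V → ℝ}
    (hT : IsMultilinear₄ T) {ι : Type*} [Fintype ι] [DecidableEq ι]
    (e : NullFrame (fun u v => B u v) ι) (h : VanishesAbove B T e.l 0)
    (huniq : (¬ ∀ a b c d, T a b c d = 0) → ∀ v, BoostOrderLE (fun u v => B u v) T v (-1) →
      ∃ r : ℝ, v = r • e.l) :
    alignmentType (fun u v => B u v) T = if ∀ a b c d, T a b c d = 0 then .O
      else if VanishesAbove B T e.l (-2) then .N
      else if VanishesAbove B T e.l (-1) then .III else .II := by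
  -- The least boost order is attained along `e.l`: other candidates are multiples of it, and
  -- rescaling preserves the flag.
  have hiff (h0 : ¬ ∀ a b c d, T a b c d = 0) (k : ℤ) (hk : k ≤ -1) :
      (∃ v, BoostOrderLE (fun u v => B u v) T v k) ↔ VanishesAbove B T e.l k := by
    refine ⟨fun ⟨v, hv⟩ => ?_, fun hv => ⟨_, e.boostOrderLE hB hT hv⟩⟩
    obtain ⟨r, rfl⟩ := huniq h0 v (hv.mono hk)
    have hr : r ≠ 0 := fun hr => hv.null.2 (by rw [hr, zero_smul])
    exact (VanishesAbove.smul_iff hr).1 (hv.vanishesAbove hB hT)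
  unfold alignmentType
  by_cases h0 : ∀ a b c d, T a b c d = 0
  · rw [if_pos h0, if_pos h0]
  · simp only [if_neg h0, hiff h0 (-2) (by norm_num), hiff h0 (-1) le_rfl]
    rw [if_pos (⟨_, e.boostOrderLE hB hT h⟩ : ∃ v, BoostOrderLE (fun u v => B u v) T v 0)]

theorem alignmentType_eq_O_iff {B : V → V → ℝ} {T : V → V → V → V → ℝ} :
    alignmentType B T = .O ↔ ∀ a b c d, T a b c d = 0 := by
  unfold alignmentType
  split_ifs <;> simp_all

end BoostOrder

/-! ### Orthogonal sums with a Euclidean space -/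

section OrthogonalSum

variable {V F : Type*} [AddCommGroup V] [Module ℝ V] [NormedAddCommGroup F] [InnerProductSpace ℝ F]
  {B : V →ₗ[ℝ] V →ₗ[ℝ] ℝ} {B' : V × F →ₗ[ℝ] V × F →ₗ[ℝ] ℝ}
  {T : V → V → V → V → ℝ} {T' : V × F → V × F → V × F → V × F → ℝ}

theorem fst_mem_boostFlag (hB' : ∀ u v, B' u v = B u.1 v.1 + inner ℝ u.2 v.2) {l : V} {w : ℤ}
    {a : V × F} (ha : a ∈ boostFlag B' (l, 0) w) : a.1 ∈ boostFlag B l w := by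
  rcases boostFlag_cases ha with h | ⟨rfl, h⟩ | ⟨rfl, r, rfl⟩ | rfl
  · exact mem_boostFlag_of_le_neg_one h
  · rw [mem_boostFlag_zero]
    simpa [hB'] using h
  · exact Submodule.smul_mem _ _ (self_mem_boostFlag_one l)
  · exact zero_mem _

theorem inl_mem_boostFlag (hB' : ∀ u v, B' u v = B u.1 v.1 + inner ℝ u.2 v.2) {l : V} {w : ℤ}
    {a : V} (ha : a ∈ boostFlag B l w) : ((a, 0) : V × F) ∈ boostFlag B' (l, 0) w := by
  rcases boostFlag_cases ha with h | ⟨rfl, h⟩ | ⟨rfl, r, rfl⟩ | rfl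
  · exact mem_boostFlag_of_le_neg_one h
  · rw [mem_boostFlag_zero]
    simpa [hB'] using h
  · have : ((r • l, 0) : V × F) = r • (l, 0) := by simp
    rw [this]
    exact Submodule.smul_mem _ _ (self_mem_boostFlag_one _)
  · exact zero_mem _

/-- The boost order along `l` is unchanged when a tensor is lifted to the orthogonal sum and
terms of boost weight `-2` are added. -/
theorem vanishesAbove_lift_iff (hB : ∀ u v, B u v = B v u)
    (hB' : ∀ u v, B' u v = B u.1 v.1 + inner ℝ u.2 v.2) {l : V} (hl : B l l = 0) {α β : ℝ}
    (hT' : ∀ a b c d, T' a b c d = T a.1 b.1 c.1 d.1 + α * nullKN B l a.1 b.1 c.1 d.1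
      - β * nullKN B' (l, 0) a b c d) {k : ℤ} (hk : -2 ≤ k) :
    VanishesAbove B' T' (l, 0) k ↔ VanishesAbove B T l k := by
  have hB's (u v) : B' u v = B' v u := by rw [hB', hB', hB, real_inner_comm]
  have hl' : B' (l, 0) (l, 0) = 0 := by simp [hB', hl]
  have hK := nullKN_vanishesAbove hB hl hk
  have hK' := nullKN_vanishesAbove hB's hl' hk
  constructor <;> intro h w₁ w₂ w₃ w₄ hw a ha b hb c hc d hd
  · have ha' := inl_mem_boostFlag hB' ha
    have hb' := inl_mem_boostFlag hB' hb
    have hc' := inl_mem_boostFlag hB' hc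
    have hd' := inl_mem_boostFlag hB' hd
    have := h _ _ _ _ hw _ ha' _ hb' _ hc' _ hd'
    rw [hT', hK _ _ _ _ hw _ ha _ hb _ hc _ hd, hK' _ _ _ _ hw _ ha' _ hb' _ hc' _ hd'] at this
    simpa using this
  · have ha' := fst_mem_boostFlag hB' ha
    have hb' := fst_mem_boostFlag hB' hb
    have hc' := fst_mem_boostFlag hB' hc
    have hd' := fst_mem_boostFlag hB' hd
    rw [hT', hK _ _ _ _ hw _ ha' _ hb' _ hc' _ hd', hK' _ _ _ _ hw _ ha _ hb _ hc _ hd,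
      h _ _ _ _ hw _ ha' _ hb' _ hc' _ hd']
    simp

/-- The pulled back terms see only base components, so a Euclidean vector in the last slot removes
them and isolates the `β` term. -/
theorem lift_apply_inr_right (hB' : ∀ u v, B' u v = B u.1 v.1 + inner ℝ u.2 v.2)
    (hT : IsMultilinear₄ T) {l : V} {α β : ℝ}
    (hT' : ∀ a b c d, T' a b c d = T a.1 b.1 c.1 d.1 + α * nullKN B l a.1 b.1 c.1 d.1
      - β * nullKN B' (l, 0) a b c d) (a b c : V × F) (w : F) :
    T' a b c (0, w) = β * (B' a (0, w) * (B l c.1 * B l b.1) - B' b (0, w) * (B l c.1 * B l a.1)) := by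
  have h := (hT.fth a.1 b.1 c.1).map_zero
  rw [hT', h]
  simp [nullKN, hB']
  ring

/-- Null vectors along which the lifted tensor has boost order at most `0` are orthogonal
to `l`. -/
theorem inner_null_eq_zero_of_vanishesAbove [Nontrivial F]
    (hB' : ∀ u v, B' u v = B u.1 v.1 + inner ℝ u.2 v.2) (hB : ∀ u v, B u v = B v u)
    (hT : IsMultilinear₄ T) {l : V} (hl : B l l = 0) {α β : ℝ} (hβ : β ≠ 0)
    (hT' : ∀ a b c d, T' a b c d = T a.1 b.1 c.1 d.1 + α * nullKN B l a.1 b.1 c.1 d.1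
      - β * nullKN B' (l, 0) a b c d) {v : V × F} (hv : VanishesAbove B' T' v 0) :
    B l v.1 = 0 := by
  -- The total weight is `1 + 0 + 1 - 1 = 1 > 0`.
  have key (x : V × F) (w : F) (hx : B' v x = 0) : T' v x v (0, w) = 0 :=
    hv 1 0 1 (-1) (by norm_num) _ (self_mem_boostFlag_one v) _ (mem_boostFlag_zero.2 hx) _
      (self_mem_boostFlag_one v) _ (mem_boostFlag_of_le_neg_one le_rfl)
  simp only [lift_apply_inr_right hB' hT hT', hB', mul_eq_zero, hβ, false_or] at key
  by_cases h2 : v.2 = 0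
  · obtain ⟨w, hw⟩ := exists_ne (0 : F)
    -- What remains is `-β * ⟪w, w⟫ * (B l v.1)^2 = 0`.
    have := key (0, w) w (by simp [h2])
    simpa [h2, hw] using this
  · have hn : (inner ℝ v.2 v.2 : ℝ) ≠ 0 := inner_self_ne_zero.2 h2
    -- The Euclidean part makes the vector orthogonal to `v`. As `l` is null, the identity reduces
    -- to `β * (B l v.1)^3 = 0`.
    have := key (l, -(B l v.1 / inner ℝ v.2 v.2) • v.2) v.2 (by
      simp only [inner_smul_right, hB v.1 l]
      field_simp
      ring)
    simp only [inner_smul_left, hl, map_zero, mul_zero, zero_add, zero_sub] at this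
    simpa [h2] using this

/-- The pointwise content of (i). Boost orders along `l` agree on both sides, and in each space the
directions that could lower the order are multiples of `l`, so both types can be read off along `l`.
-/
theorem alignment_lift [Nontrivial F] (hB : ∀ u v, B u v = B v u)
    (hB' : ∀ u v, B' u v = B u.1 v.1 + inner ℝ u.2 v.2)
    (hT : IsMultilinear₄ T) {α β : ℝ} (hβ : β ≠ 0) {l : V}
    (hT' : ∀ a b c d, T' a b c d = T a.1 b.1 c.1 d.1 + α * nullKN B l a.1 b.1 c.1 d.1
      - β * nullKN B' (l, 0) a b c d)
    {ι κ : Type*} [Fintype ι] [DecidableEq ι] [Fintype κ] [DecidableEq κ]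
    (e : NullFrame (fun u v => B u v) ι) (e' : NullFrame (fun u v => B' u v) κ) (he : e.l = l)
    (he' : e'.l = (l, 0)) (h : VanishesAbove B T l 0) :
    (alignmentType (fun u v => B u v) T ≠ .O →
      alignmentType (fun u v => B' u v) T' = alignmentType (fun u v => B u v) T) ∧
    (alignmentType (fun u v => B u v) T = .O → alignmentType (fun u v => B' u v) T' = .N) ∧
    ∀ v, BoostOrderLE (fun u v => B' u v) T' v 0 ↔ ∃ r : ℝ, r ≠ 0 ∧ v = r • (l, (0 : F)) := by
  have hB's (u v) : B' u v = B' v u := by rw [hB', hB', hB, real_inner_comm]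
  have hl : B l l = 0 := he ▸ e.l_l
  have hT'm : IsMultilinear₄ T' := by
    have hK := nullKN_isMultilinear₄ B l
    have hK' := nullKN_isMultilinear₄ B' (l, 0)
    constructor <;> intros <;> constructor <;> intros <;>
      simp only [hT', Prod.fst_add, Prod.smul_fst, (hT.fst _ _ _).map_add, (hT.snd _ _ _).map_add,
        (hT.trd _ _ _).map_add, (hT.fth _ _ _).map_add, (hT.fst _ _ _).map_smul,
        (hT.snd _ _ _).map_smul, (hT.trd _ _ _).map_smul, (hT.fth _ _ _).map_smul,
        (hK.fst _ _ _).map_add, (hK.snd _ _ _).map_add,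
        (hK.trd _ _ _).map_add, (hK.fth _ _ _).map_add, (hK.fst _ _ _).map_smul,
        (hK.snd _ _ _).map_smul, (hK.trd _ _ _).map_smul, (hK.fth _ _ _).map_smul,
        (hK'.fst _ _ _).map_add, (hK'.snd _ _ _).map_add,
        (hK'.trd _ _ _).map_add, (hK'.fth _ _ _).map_add, (hK'.fst _ _ _).map_smul,
        (hK'.snd _ _ _).map_smul, (hK'.trd _ _ _).map_smul, (hK'.fth _ _ _).map_smul,
        smul_eq_mul] <;> ring
  have hlift (k : ℤ) (hk : -2 ≤ k) : VanishesAbove B' T' e'.l k ↔ VanishesAbove B T e.l k := by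
    rw [he, he']
    exact vanishesAbove_lift_iff hB hB' hl hT' hk
  rw [← he] at h
  have h' : VanishesAbove B' T' e'.l 0 := (hlift 0 (by norm_num)).2 h
  have huniq' (v : V × F) (hv : BoostOrderLE (fun u v => B' u v) T' v 0) :
      ∃ r : ℝ, v = r • e'.l := by
    have h1 := inner_null_eq_zero_of_vanishesAbove hB' hB hT hl hβ hT' (hv.vanishesAbove hB's hT'm)
    exact e'.exists_smul_eq hB's hv.null.1 (by simp [he', hB', h1])
  have huniq (h0 : ¬ ∀ a b c d, T a b c d = 0) (v : V)
      (hv : BoostOrderLE (fun u v => B u v) T v (-1)) : ∃ r : ℝ, v = r • e.l := by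
    refine e.exists_smul_eq hB hv.null.1 ?_
    by_contra hs
    exact h0 (eq_zero_of_vanishesAbove hB hT e.l_l hv.null.1 hs h (hv.vanishesAbove hB hT))
  -- The component on `n, w, n, w` equals `-β * ⟪w, w⟫`, because `B l n = 1`. It is non-zero even
  -- when `T = 0`.
  have h0' : ¬ ∀ a b c d, T' a b c d = 0 := by
    intro h0
    obtain ⟨w, hw⟩ := exists_ne (0 : F)
    have h1 := h0 (e.n, 0) (0, w) (e.n, 0) (0, w)
    rw [lift_apply_inr_right hB' hT hT'] at h1
    have := e.l_n
    rw [he] at this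
    simp [hB', this, hβ, hw] at h1
  have ht := alignmentType_eq hB hT e h huniq
  have ht' := alignmentType_eq hB's hT'm e' h' (fun _ v hv => huniq' v (hv.mono (by norm_num)))
  rw [if_neg h0', hlift _ le_rfl, hlift _ (by norm_num)] at ht'
  refine ⟨fun hO => ?_, fun hO => ?_, fun v => ⟨fun hv => ?_, ?_⟩⟩
  · rw [ne_eq, alignmentType_eq_O_iff] at hO
    rw [ht, ht', if_neg hO]
  · rw [alignmentType_eq_O_iff] at hO
    have hN : VanishesAbove B T e.l (-2) := fun _ _ _ _ _ _ _ _ _ _ _ _ _ => hO _ _ _ _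
    rw [ht', if_pos hN]
  · obtain ⟨r, rfl⟩ := huniq' v hv
    exact ⟨r, fun hr => hv.null.2 (by rw [hr, zero_smul]), by rw [he']⟩
  · rintro ⟨r, hr, rfl⟩
    rw [← he']
    exact (e'.boost hr).boostOrderLE hB's hT'm ((VanishesAbove.smul_iff hr).2 h')

end OrthogonalSum

end

noncomputable section

/-! ### Curvature of a product with Euclidean space, in coordinates -/

/-- The derivative of `z ↦ L (f z.1)` for `L` with a left inverse, without any differentiability
assumption on `f`. -/
theorem fderiv_comp_fst_of_leftInverse {E F A A' : Type*} [NormedAddCommGroup E] [NormedSpace ℝ E]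
    [NormedAddCommGroup F] [NormedSpace ℝ F] [NormedAddCommGroup A] [NormedSpace ℝ A]
    [NormedAddCommGroup A'] [NormedSpace ℝ A'] (L : A →L[ℝ] A') (R : A' →L[ℝ] A)
    (hRL : ∀ a, R (L a) = a) (f : E → A) (z : E × F) :
    fderiv ℝ (fun z : E × F => L (f z.1)) z =
      L ∘L fderiv ℝ f z.1 ∘L ContinuousLinearMap.fst ℝ E F := by
  by_cases hf : DifferentiableAt ℝ f z.1
  · exact (L.hasFDerivAt.comp z (hf.hasFDerivAt.comp z hasFDerivAt_fst)).fderiv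
  · rw [fderiv_zero_of_not_differentiableAt hf, fderiv_zero_of_not_differentiableAt]
    · simp
    · intro h
      refine hf ?_
      -- `f` is recovered by restricting to the slice through `z` and applying `R`. So both sides
      -- are non-differentiable together, and both derivatives take the default value `0`.
      have h1 : DifferentiableAt ℝ (fun y : E => (y, z.2)) z.1 := by fun_prop
      have h2 := R.differentiableAt.comp z.1 (DifferentiableAt.comp z.1 (g := fun z : E × F => L (f z.1)) h h1)
      simpa [Function.comp_def, hRL] using h2

namespace CoordMetric

variable {E F : Type*} [NormedAddCommGroup E] [NormedSpace ℝ E]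
  [NormedAddCommGroup F] [InnerProductSpace ℝ F]

/-- The pullback of bilinear forms under the first projection of a product. -/
def pullFst (E F A : Type*) [NormedAddCommGroup E] [NormedSpace ℝ E]
    [NormedAddCommGroup F] [NormedSpace ℝ F] [NormedAddCommGroup A] [NormedSpace ℝ A] :
    (E →L[ℝ] E →L[ℝ] A) →L[ℝ] (E × F →L[ℝ] E × F →L[ℝ] A) :=
  (ContinuousLinearMap.compL ℝ _ _ _ (ContinuousLinearMap.precomp A (.fst ℝ E F))) ∘L
    ContinuousLinearMap.precomp _ (.fst ℝ E F)

/-- The restriction of bilinear forms to the first factor of a product. -/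
def restrictFst (E F A : Type*) [NormedAddCommGroup E] [NormedSpace ℝ E]
    [NormedAddCommGroup F] [NormedSpace ℝ F] [NormedAddCommGroup A] [NormedSpace ℝ A] :
    (E × F →L[ℝ] E × F →L[ℝ] A) →L[ℝ] (E →L[ℝ] E →L[ℝ] A) :=
  (ContinuousLinearMap.compL ℝ _ _ _ (ContinuousLinearMap.precomp A (.inl ℝ E F))) ∘L
    ContinuousLinearMap.precomp _ (.inl ℝ E F)

/-- On the open set `U`, the metric `K` is the orthogonal sum of `G` and the Euclidean metric. -/
def IsProdOn (G : E → E →L[ℝ] E →L[ℝ] ℝ) (K : E × F → E × F →L[ℝ] E × F →L[ℝ] ℝ)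
    (U : Set (E × F)) : Prop :=
  ∀ z ∈ U, ∀ u v, K z u v = G z.1 u.1 v.1 + inner ℝ u.2 v.2

variable {G : E → E →L[ℝ] E →L[ℝ] ℝ} {K : E × F → E × F →L[ℝ] E × F →L[ℝ] ℝ} {U : Set (E × F)}

theorem IsProdOn.fderiv_apply (h : IsProdOn G K U) (hU : IsOpen U) {z : E × F} (hz : z ∈ U)
    (u v w : E × F) : fderiv ℝ K z u v w = fderiv ℝ G z.1 u.1 v.1 w.1 := by
  have hK : K =ᶠ[nhds z] fun z => pullFst E F ℝ (G z.1) +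
      (ContinuousLinearMap.precomp ℝ (.snd ℝ E F)) ∘L (innerSL ℝ) ∘L (.snd ℝ E F) := by
    filter_upwards [hU.mem_nhds hz] with y hy
    exact ContinuousLinearMap.ext fun u => ContinuousLinearMap.ext fun v => h y hy u v
  rw [hK.fderiv_eq, fderiv_add_const, fderiv_comp_fst_of_leftInverse (pullFst E F ℝ)
    (restrictFst E F ℝ) (fun _ => rfl)]
  rfl

/-- The inverse of a block diagonal form is block diagonal. If `G` is degenerate, so is `K`, and
both inverses are `0` by convention, so no nondegeneracy assumption is needed. -/
theorem IsProdOn.inverse_apply (h : IsProdOn G K U) {z : E × F} (hz : z ∈ U)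
    [CompleteSpace F] (φ : E →L[ℝ] ℝ) :
    (K z).inverse (φ ∘L .fst ℝ E F) = ((G z.1).inverse φ, 0) := by
  by_cases hG : (G z.1).IsInvertible
  · have hK : (K z).IsInvertible := by
      let J : (E × F →L[ℝ] ℝ) →L[ℝ] E × F :=
        ((G z.1).inverse ∘L ContinuousLinearMap.precomp ℝ (.inl ℝ E F)).prod
          ((InnerProductSpace.toDual ℝ F).symm.toContinuousLinearEquiv.toContinuousLinearMap ∘L
            ContinuousLinearMap.precomp ℝ (.inr ℝ E F))
      refine ContinuousLinearMap.IsInvertible.of_inverse (g := J) ?_ ?_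
      · refine ContinuousLinearMap.ext fun ψ => ContinuousLinearMap.ext fun v => ?_
        simp only [ContinuousLinearMap.comp_apply, h z hz]
        simp only [J, ContinuousLinearMap.prod_apply, ContinuousLinearMap.comp_apply]
        rw [hG.self_apply_inverse]
        have : (inner ℝ ((InnerProductSpace.toDual ℝ F).symm (ψ ∘L .inr ℝ E F)) v.2 : ℝ) =
          ψ (0, v.2) := InnerProductSpace.toDual_symm_apply
        refine (congrArg (ψ (v.1, 0) + ·) this).trans ?_
        rw [← map_add]
        simp
      · refine ContinuousLinearMap.ext fun v => Prod.ext ?_ ?_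
        · have : K z v ∘L .inl ℝ E F = G z.1 v.1 := by ext w; simp [h z hz]
          exact (congrArg (G z.1).inverse this).trans (hG.inverse_apply_self _)
        · have : K z v ∘L .inr ℝ E F = InnerProductSpace.toDual ℝ F v.2 := by
            ext w; simp [h z hz]
          exact (congrArg (InnerProductSpace.toDual ℝ F).symm this).trans (by simp)
    rw [hK.inverse_apply_eq]
    ext v <;> simp [h z hz, hG.self_apply_inverse]
  · have hK : ¬ (K z).IsInvertible := by
      intro hK
      -- Compressing the inverse of `K` to the first factor inverts `G`.
      refine hG (ContinuousLinearMap.IsInvertible.of_inverse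
        (g := .fst ℝ E F ∘L (K z).inverse ∘L ContinuousLinearMap.precomp ℝ (.fst ℝ E F)) ?_ ?_)
      · refine ContinuousLinearMap.ext fun ψ => ContinuousLinearMap.ext fun v => ?_
        have h1 := hK.self_apply_inverse (ψ ∘L .fst ℝ E F)
        have h2 := DFunLike.congr_fun h1 ((v, 0) : E × F)
        rw [h z hz] at h2
        simpa using h2
      · refine ContinuousLinearMap.ext fun v => ?_
        have h1 : G z.1 v ∘L .fst ℝ E F = K z (v, 0) := by
          ext w <;> simp [h z hz]
        have h2 : (K z).inverse (G z.1 v ∘L .fst ℝ E F) = (v, 0) := by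
          rw [h1, hK.inverse_apply_self]
        exact congrArg Prod.fst h2
    rw [ContinuousLinearMap.inverse_of_not_isInvertible hG,
      ContinuousLinearMap.inverse_of_not_isInvertible hK]
    rfl

variable [CompleteSpace F]

/-- Stated as an injection with left inverse applied to `christoffel G z.1`, so that
`fderiv_comp_fst_of_leftInverse` can differentiate it. -/
theorem IsProdOn.christoffel_eq (h : IsProdOn G K U) (hU : IsOpen U) {z : E × F} (hz : z ∈ U) :
    christoffel K z = pullFst E F (E × F)
      ((ContinuousLinearMap.compL ℝ _ _ _ (ContinuousLinearMap.compL ℝ _ _ _ (.inl ℝ E F)))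
        (christoffel G z.1)) := by
  refine ContinuousLinearMap.ext fun u => ContinuousLinearMap.ext fun v => ?_
  have h1 : christoffelLow K z u v = christoffelLow G z.1 u.1 v.1 ∘L .fst ℝ E F := by
    refine ContinuousLinearMap.ext fun w => ?_
    rw [ContinuousLinearMap.comp_apply, christoffelLow_apply, christoffelLow_apply]
    simp only [h.fderiv_apply hU hz]
    rfl
  rw [christoffel_apply, h1, h.inverse_apply hz]
  rfl

theorem IsProdOn.christoffel_apply (h : IsProdOn G K U) (hU : IsOpen U) {z : E × F} (hz : z ∈ U)
    (u v : E × F) : christoffel K z u v = (christoffel G z.1 u.1 v.1, 0) := by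
  rw [h.christoffel_eq hU hz]
  rfl

theorem IsProdOn.fderiv_christoffel_apply (h : IsProdOn G K U) (hU : IsOpen U) {z : E × F}
    (hz : z ∈ U) (u v w : E × F) :
    fderiv ℝ (christoffel K) z u v w = (fderiv ℝ (christoffel G) z.1 u.1 v.1 w.1, 0) := by
  have hK := Filter.eventually_of_mem (hU.mem_nhds hz) fun y hy => h.christoffel_eq hU hy
  rw [Filter.EventuallyEq.fderiv_eq hK]
  have := fderiv_comp_fst_of_leftInverse (F := F) (pullFst E F (E × F) ∘L
      (ContinuousLinearMap.compL ℝ _ _ _ (ContinuousLinearMap.compL ℝ _ _ _ (.inl ℝ E F))))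
    ((ContinuousLinearMap.compL ℝ _ _ _ (ContinuousLinearMap.compL ℝ _ _ _ (.fst ℝ E F))) ∘L
      restrictFst E F (E × F)) (fun _ => rfl) (christoffel G) z
  exact DFunLike.congr_fun (DFunLike.congr_fun (DFunLike.congr_fun this u) v) w

theorem IsProdOn.riemannOp_apply (h : IsProdOn G K U) (hU : IsOpen U) {z : E × F} (hz : z ∈ U)
    (u v w : E × F) : riemannOp K z u v w = (riemannOp G z.1 u.1 v.1 w.1, 0) := by
  simp [riemannOp, h.fderiv_christoffel_apply hU hz, h.christoffel_apply hU hz]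

theorem IsProdOn.riemann_eq (h : IsProdOn G K U) (hU : IsOpen U) {z : E × F} (hz : z ∈ U)
    (a b c d : E × F) : riemann K z a b c d = riemann G z.1 a.1 b.1 c.1 d.1 := by
  simp [riemann, h.riemannOp_apply hU hz, h z hz]

/-! ### Ricci, scalar and Weyl curvature of the product -/

variable [FiniteDimensional ℝ E] [FiniteDimensional ℝ F]

/-- The curvature map factors through the projection and inclusion of the first factor. Cyclicity of
the trace reduces it to the trace over `E`. -/
theorem IsProdOn.ricci_apply (h : IsProdOn G K U) (hU : IsOpen U) {z : E × F} (hz : z ∈ U)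
    (u v : E × F) : ricci K z u v = ricci G z.1 u.1 v.1 := by
  have h1 : riemannTraceMap K z u v = LinearMap.inl ℝ E F ∘ₗ
      (riemannTraceMap G z.1 u.1 v.1 ∘ₗ LinearMap.fst ℝ E F) :=
    LinearMap.ext fun w => h.riemannOp_apply hU hz w v u
  have h2 : (riemannTraceMap G z.1 u.1 v.1 ∘ₗ LinearMap.fst ℝ E F) ∘ₗ LinearMap.inl ℝ E F =
      riemannTraceMap G z.1 u.1 v.1 := rfl
  change LinearMap.trace ℝ _ (riemannTraceMap K z u v) =
    LinearMap.trace ℝ _ (riemannTraceMap G z.1 u.1 v.1)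
  rw [h1, LinearMap.trace_comp_comm', h2]

/-- The scalar curvature vanishes if the Ricci tensor is of the form `η l_a l_b` with a null
vector `l`. -/
theorem scalar_eq_zero {G : E → E →L[ℝ] E →L[ℝ] ℝ} {y l : E} {η : ℝ} (hl : G y l l = 0)
    (h : ∀ u v, ricci G y u v = η * (G y l u * G y l v)) : scalar G y = 0 := by
  unfold scalar
  -- The Ricci operator has rank one, so its trace is `η * G y l l = 0`.
  have h1 : (G y).inverse.toLinearMap ∘ₗ
      (LinearMap.toContinuousLinearMap : (E →ₗ[ℝ] ℝ) ≃ₗ[ℝ] (E →L[ℝ] ℝ)).toLinearMap ∘ₗ ricci G y =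
      (LinearMap.toSpanSingleton ℝ E (η • (G y).inverse (G y l))) ∘ₗ (G y l).toLinearMap := by
    refine LinearMap.ext fun u => ?_
    have : LinearMap.toContinuousLinearMap (ricci G y u) = (G y l u) • η • G y l := by
      ext v
      simp [h]
      ring
    simp [this]
  rw [h1, LinearMap.trace_comp_comm']
  by_cases hG : (G y).IsInvertible
  · rw [hG.inverse_apply_self]
    have h2 : (G y l).toLinearMap ∘ₗ LinearMap.toSpanSingleton ℝ E (η • l) = 0 := by
      ext
      simp [hl]
    rw [h2, map_zero]
  · rw [ContinuousLinearMap.inverse_of_not_isInvertible hG]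
    simp

theorem weyl_isMultilinear₄ (G : E → E →L[ℝ] E →L[ℝ] ℝ) (y : E) :
    IsMultilinear₄ (weyl G y) := by
  constructor <;> intros <;> constructor <;> intros <;>
    simp [weyl, riemann, riemannOp] <;> ring

/-- The Weyl tensor when the Ricci tensor is of the form `η l_a l_b` with a null vector `l`. -/
theorem weyl_eq {G : E → E →L[ℝ] E →L[ℝ] ℝ} {y l : E} {η : ℝ} (hl : G y l l = 0)
    (h : ∀ u v, ricci G y u v = η * (G y l u * G y l v)) (a b c d : E) :
    weyl G y a b c d = riemann G y a b c d
      - η / ((Module.finrank ℝ E : ℝ) - 2) * nullKN (G y).toLinearMap₁₂ l a b c d := by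
  have hG (u v : E) : (G y).toLinearMap₁₂ u v = G y u v := rfl
  simp only [weyl, scalar_eq_zero hl h, h, nullKN, hG]
  ring

theorem IsProdOn.ricci_eq (h : IsProdOn G K U) (hU : IsOpen U) {z : E × F} (hz : z ∈ U)
    {l : E} {η : ℝ} (hric : ∀ u v, ricci G z.1 u v = η * (G z.1 l u * G z.1 l v))
    (u v : E × F) : ricci K z u v = η * (K z (l, 0) u * K z (l, 0) v) := by
  simp [h.ricci_apply hU hz, hric, h z hz]

/-- The Riemann tensors agree, so the Weyl tensors differ only in their trace terms, with the
respective denominators `d - 2`. -/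
theorem IsProdOn.weyl_eq (h : IsProdOn G K U) (hU : IsOpen U) {z : E × F} (hz : z ∈ U)
    {l : E} {η : ℝ} (hl : G z.1 l l = 0)
    (hric : ∀ u v, ricci G z.1 u v = η * (G z.1 l u * G z.1 l v)) (a b c d : E × F) :
    weyl K z a b c d = weyl G z.1 a.1 b.1 c.1 d.1
      + η / ((Module.finrank ℝ E : ℝ) - 2) * nullKN (G z.1).toLinearMap₁₂ l a.1 b.1 c.1 d.1
      - η / ((Module.finrank ℝ (E × F) : ℝ) - 2) * nullKN (K z).toLinearMap₁₂ (l, 0) a b c d := by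
  rw [CoordMetric.weyl_eq (by simp [h z hz, hl]) (h.ricci_eq hU hz hric),
    CoordMetric.weyl_eq hl hric, h.riemann_eq hU hz]
  ring

end CoordMetric

end

noncomputable section

/-! ### The product manifold -/

namespace LorentzMetric

variable {E : Type*} [NormedAddCommGroup E] [NormedSpace ℝ E]
  {H : Type*} [TopologicalSpace H] {I : ModelWithCorners ℝ E H}
  {M : Type*} [TopologicalSpace M] [ChartedSpace H M] [IsManifold I ∞ M]

/-- Tangent spaces are copies of `E` through the preferred chart at each point, and the coordinate
change from that chart to itself is the identity. -/
theorem toCoord_apply (x : M) (v : TangentSpace I x) : toCoord x v = (v : E) := by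
  have : IsManifold I 1 M := IsManifold.of_le (n := ∞) (by simp)
  have h := TangentBundle.continuousLinearMapAt_trivializationAt (I := I)
    (mem_chart_source H x)
  have h2 := DFunLike.congr_fun h v
  refine h2.symm.trans ?_
  rw [TangentBundle.continuousLinearMapAt_trivializationAt_eq_core (mem_chart_source H x)]
  exact (tangentBundleCore I M).coordChange_self (achart H x) x (mem_achart_source H x) v

theorem mfderivWithin_extChartAt_symm_self_apply (x : M) (v : E) :
    mfderivWithin 𝓘(ℝ, E) I (extChartAt I x).symm (Set.range I) (extChartAt I x x) v = v := by
  have : IsManifold I 1 M := IsManifold.of_le (n := ∞) (by simp)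
  have h := TangentBundle.symmL_trivializationAt (I := I) (mem_chart_source H x)
  have h2 := DFunLike.congr_fun h v
  refine h2.symm.trans ?_
  rw [TangentBundle.symmL_trivializationAt_eq_core (mem_chart_source H x)]
  exact (tangentBundleCore I M).coordChange_self (achart H x) x (mem_achart_source H x) v

theorem coord_self (g : LorentzMetric I M) (x : M) :
    g.coord x (extChartAt I x x) = (g.metric x : E →L[ℝ] E →L[ℝ] ℝ) := by
  refine ContinuousLinearMap.ext fun u => ContinuousLinearMap.ext fun v => ?_
  have h (w : E) := mfderivWithin_extChartAt_symm_self_apply (I := I) x w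
  -- The two base points are only propositionally equal, so the metrics are compared as forms on the
  -- common model space `E`.
  have key (z : M) (hz : z = x) (a b : E) :
      (g.metric z : E →L[ℝ] E →L[ℝ] ℝ) a b = (g.metric x : E →L[ℝ] E →L[ℝ] ℝ) a b := by
    subst hz
    rfl
  refine (key _ (extChartAt_to_inv x) _ _).trans ?_
  exact congrArg₂ (fun a b : E => (g.metric x : E →L[ℝ] E →L[ℝ] ℝ) a b) (h u) (h v)

/-- The preferred chart of the product is a product chart, the identity on the Euclidean factor, so
its differential splits. -/
theorem isProdOn_coord (g : LorentzMetric I M) {k : ℕ} (x : M × EuclideanSpace ℝ (Fin k)) :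
    CoordMetric.IsProdOn (g.coord x.1) ((g.prodEuclidean k).coord x)
      ((extChartAt I x.1).target ×ˢ Set.univ) := by
  rintro ⟨y, q⟩ ⟨hy, -⟩ u v
  have : IsManifold I 1 M := IsManifold.of_le (n := ∞) (by simp)
  have : IsManifold (I.prod (𝓡 k)) 1 (M × EuclideanSpace ℝ (Fin k)) :=
    IsManifold.of_le (n := ∞) (by simp)
  have hz : (extChartAt I x.1).symm y ∈ (chartAt H x.1).source := by
    simpa using (extChartAt I x.1).map_target hy
  let z : M × EuclideanSpace ℝ (Fin k) := ((extChartAt I x.1).symm y, q)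
  have hz' : z ∈ (chartAt (ModelProd H (EuclideanSpace ℝ (Fin k))) x).source :=
    ⟨hz, Set.mem_univ _⟩
  have hs : (extChartAt (I.prod (𝓡 k)) x).symm (y, q) = z := by
    rw [extChartAt_prod]
    rfl
  have ht : extChartAt (I.prod (𝓡 k)) x z = (y, q) := by
    rw [extChartAt_prod]
    exact Prod.ext ((extChartAt I x.1).right_inv hy) rfl
  have hu := proj_symmL (I := I) k x z hz u
  have hv := proj_symmL (I := I) k x z hz v
  rw [TangentBundle.symmL_trivializationAt hz', TangentBundle.symmL_trivializationAt hz, ht] at hu hv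
  have hr : extChartAt I x.1 z.1 = y := (extChartAt I x.1).right_inv hy
  rw [hr] at hu hv
  rw [coord_apply, coord_apply]
  have key (z' : M × EuclideanSpace ℝ (Fin k)) (hz : z' = z) (a b : E × EuclideanSpace ℝ (Fin k)) :
      (g.prodMetric k z' : E × EuclideanSpace ℝ (Fin k) →L[ℝ]
        E × EuclideanSpace ℝ (Fin k) →L[ℝ] ℝ) a b = g.prodMetric k z a b := by
    subst hz
    rfl
  refine (key _ hs _ _).trans ((prodMetric_apply g k z _ _).trans ?_)
  exact congrArg₂ (· + ·) (congrArg₂ (fun a b => g.metric z.1 a b) hu.1 hv.1)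
    (congrArg₂ (fun a b => inner ℝ a b) hu.2 hv.2)

theorem fieldCoord_liftField (l : ∀ p : M, TangentSpace I p) {k : ℕ}
    (x : M × EuclideanSpace ℝ (Fin k)) {y : E × EuclideanSpace ℝ (Fin k)}
    (hy : y.1 ∈ (extChartAt I x.1).target) :
    fieldCoord (liftField k l) x y = (fieldCoord l x.1 y.1, 0) := by
  have : IsManifold I 1 M := IsManifold.of_le (n := ∞) (by simp)
  have hz : (extChartAt I x.1).symm y.1 ∈ (chartAt H x.1).source := by
    simpa using (extChartAt I x.1).map_target hy
  let z : M × EuclideanSpace ℝ (Fin k) := ((extChartAt I x.1).symm y.1, y.2)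
  have hs : (extChartAt (I.prod (𝓡 k)) x).symm y = z := by
    rw [extChartAt_prod]
    rfl
  have hm := mfderiv_prodMap (p := z) (I' := 𝓡 k) (J' := 𝓡 k)
    (g := (id : EuclideanSpace ℝ (Fin k) → EuclideanSpace ℝ (Fin k)))
    (mdifferentiableAt_extChartAt (I := I) hz) mdifferentiableAt_id
  rw [← modelWithCornersSelf_prod, chartedSpaceSelf_prod] at hm
  have he : (extChartAt (I.prod (𝓡 k)) x : M × EuclideanSpace ℝ (Fin k) →
      E × EuclideanSpace ℝ (Fin k)) = Prod.map (extChartAt I x.1) id := by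
    rw [extChartAt_prod]
    rfl
  unfold fieldCoord
  rw [hs, he]
  refine (DFunLike.congr_fun hm (liftField k l z)).trans (Prod.ext rfl ?_)
  exact ContinuousLinearMap.map_zero (mfderiv (𝓡 k) (𝓡 k) id z.2)

theorem extChartAt_prod_self {k : ℕ} (x : M × EuclideanSpace ℝ (Fin k)) :
    extChartAt (I.prod (𝓡 k)) x x = (extChartAt I x.1 x.1, x.2) := by
  rw [extChartAt_prod]
  rfl

theorem mem_extChartAt_target_prod_univ {k : ℕ} (x : M × EuclideanSpace ℝ (Fin k)) :
    (extChartAt I x.1 x.1, x.2) ∈ (extChartAt I x.1).target ×ˢ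
      (Set.univ : Set (EuclideanSpace ℝ (Fin k))) :=
  ⟨mem_extChartAt_target x.1, Set.mem_univ _⟩

theorem isOpen_extChartAt_target_prod_univ [I.Boundaryless] {k : ℕ}
    (x : M × EuclideanSpace ℝ (Fin k)) :
    IsOpen ((extChartAt I x.1).target ×ˢ (Set.univ : Set (EuclideanSpace ℝ (Fin k)))) :=
  (isOpen_extChartAt_target x.1).prod isOpen_univ

theorem covDeriv_eq (g : LorentzMetric I M) (X : ∀ x : M, TangentSpace I x) (x : M)
    (v : TangentSpace I x) :
    (g.covDeriv X x v : E) = fderiv ℝ (fieldCoord X x) (extChartAt I x x) (v : E) +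
      CoordMetric.christoffel (g.coord x) (extChartAt I x x) (v : E)
        (fieldCoord X x (extChartAt I x x)) := by
  refine (mfderivWithin_extChartAt_symm_self_apply x _).trans ?_
  rw [toCoord_apply]

/-! ### Covariant derivative and optical matrix of the lifted field -/

variable [I.Boundaryless]

/-- In a product chart the lifted field is constant along the Euclidean factor, and the Christoffel
symbols have no Euclidean components. -/
theorem covDeriv_liftField (g : LorentzMetric I M) (l : ∀ p : M, TangentSpace I p) {k : ℕ}
    (x : M × EuclideanSpace ℝ (Fin k)) (v : TangentSpace (I.prod (𝓡 k)) x) :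
    (g.prodEuclidean k).covDeriv (liftField k l) x v = lift x (g.covDeriv l x.1 (projBase x v)) := by
  have hU := isOpen_extChartAt_target_prod_univ (I := I) x
  have hx := extChartAt_prod_self (I := I) x
  have hmem := mem_extChartAt_target_prod_univ (I := I) x
  have hX : fieldCoord (liftField k l) x =ᶠ[nhds (extChartAt I x.1 x.1, x.2)]
      fun z => ContinuousLinearMap.inl ℝ E (EuclideanSpace ℝ (Fin k)) (fieldCoord l x.1 z.1) :=
    Filter.eventually_of_mem (hU.mem_nhds hmem) fun z hz => fieldCoord_liftField l x hz.1
  rw [projBase_eq]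
  refine (covDeriv_eq _ _ _ _).trans (Eq.trans ?_
    (congrArg (fun w : E => ((w, 0) : E × EuclideanSpace ℝ (Fin k)))
      (covDeriv_eq g l x.1 v.1)).symm)
  have key (v : E × EuclideanSpace ℝ (Fin k)) :
      fderiv ℝ (fieldCoord (liftField k l) x) (extChartAt I x.1 x.1, x.2) v +
        CoordMetric.christoffel ((g.prodEuclidean k).coord x) (extChartAt I x.1 x.1, x.2) v
          (fieldCoord (liftField k l) x (extChartAt I x.1 x.1, x.2)) =
      (fderiv ℝ (fieldCoord l x.1) (extChartAt I x.1 x.1) v.1 +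
        CoordMetric.christoffel (g.coord x.1) (extChartAt I x.1 x.1) v.1
          (fieldCoord l x.1 (extChartAt I x.1 x.1)), 0) := by
    rw [hX.fderiv_eq, hX.eq_of_nhds, (g.isProdOn_coord x).christoffel_apply hU hmem,
      fderiv_comp_fst_of_leftInverse _ (ContinuousLinearMap.fst ℝ E (EuclideanSpace ℝ (Fin k)))
        (fun _ => rfl)]
    exact Prod.ext rfl (add_zero _)
  rw [hx]
  exact key v

/-- Euclidean columns vanish because the derivative in those directions is zero. Euclidean rows
vanish because the derivative is a lifted vector. -/
theorem opticalMatrix_liftFrame [FiniteDimensional ℝ E] (g : LorentzMetric I M)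
    (l : ∀ p : M, TangentSpace I p) {k : ℕ} (x : M × EuclideanSpace ℝ (Fin k))
    {ι κ : Type*} [Fintype ι] [DecidableEq ι] [Fintype κ] [DecidableEq κ]
    (e : NullFrame (g.form x.1) ι) (f : OrthonormalBasis κ ℝ (EuclideanSpace ℝ (Fin k))) :
    (g.prodEuclidean k).opticalMatrix (liftField k l) x (g.liftFrame x e f).m =
      Matrix.fromBlocks (g.opticalMatrix l x.1 e.m) 0 0 0 := by
  ext i j
  have hcov (w : EuclideanSpace ℝ (Fin k)) :
      g.covDeriv l x.1 (projBase x (liftEuclidean x w)) = 0 := by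
    rw [projBase_liftEuclidean]
    have h0 : fderiv ℝ (fieldCoord l x.1) (extChartAt I x.1 x.1) (0 : E) +
        CoordMetric.christoffel (g.coord x.1) (extChartAt I x.1 x.1) (0 : E)
          (fieldCoord l x.1 (extChartAt I x.1 x.1)) = 0 := by
      rw [map_zero, map_zero, zero_add, _root_.zero_apply]
    exact (covDeriv_eq g l x.1 0).trans h0
  rcases i with i | i <;> rcases j with j | j <;>
    simp only [opticalMatrix, Matrix.of_apply, covDeriv_liftField, liftFrame, Sum.elim_inl,
      Sum.elim_inr, form_lift_lift, form_lift_liftEuclidean, Matrix.fromBlocks_apply₁₁,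
      Matrix.fromBlocks_apply₁₂, Matrix.fromBlocks_apply₂₁, Matrix.fromBlocks_apply₂₂,
      Matrix.zero_apply, projBase_lift, hcov]
  simp [form]

/-! ### Ricci type, Weyl type and mWANDs of the product -/

variable [FiniteDimensional ℝ E]

theorem weyl_apply (g : LorentzMetric I M) (x : M) :
    g.weyl x = CoordMetric.weyl (g.coord x) (extChartAt I x x) := by
  funext a b c d
  rw [weyl, toCoord_apply, toCoord_apply, toCoord_apply, toCoord_apply]

theorem ricci_apply (g : LorentzMetric I M) (x : M) (u v : TangentSpace I x) :
    g.ricci x u v = CoordMetric.ricci (g.coord x) (extChartAt I x x) (u : E) (v : E) := by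
  rw [ricci, toCoord_apply, toCoord_apply]

theorem IsRicciTypeN.ricci_coord {g : LorentzMetric I M} {x : M} {η : ℝ} {l : TangentSpace I x}
    (h : g.IsRicciTypeN x η l) (u v : E) :
    CoordMetric.ricci (g.coord x) (extChartAt I x x) u v =
      η * (g.coord x (extChartAt I x x) (l : E) u * g.coord x (extChartAt I x x) (l : E) v) := by
  simp only [coord_self]
  exact (g.ricci_apply x u v).symm.trans (h.2.2.2 u v)

theorem IsRicciTypeN.prodEuclidean {g : LorentzMetric I M} {k : ℕ}
    {x : M × EuclideanSpace ℝ (Fin k)} {η : ℝ} {l : TangentSpace I x.1}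
    (h : g.IsRicciTypeN x.1 η l) : (g.prodEuclidean k).IsRicciTypeN x η (lift x l) := by
  refine ⟨h.1, fun hl => h.2.1 ?_, (g.form_lift_lift x l l).trans h.2.2.1, fun u v => ?_⟩
  · rw [← projBase_lift x l, hl, map_zero]
  have hU := isOpen_extChartAt_target_prod_univ (I := I) x
  have hx := extChartAt_prod_self (I := I) x
  have hmem := mem_extChartAt_target_prod_univ (I := I) x
  have hr := (g.isProdOn_coord x).ricci_eq hU hmem h.ricci_coord
  simp only [← hx, coord_self] at hr
  exact ((g.prodEuclidean k).ricci_apply x u v).trans (hr u v)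

/-- The Weyl type and the multiple Weyl aligned null directions of the product. -/
theorem weylType_prodEuclidean (hE : 2 < Module.finrank ℝ E) {k : ℕ} (hk : 1 ≤ k)
    {g : LorentzMetric I M} {x : M × EuclideanSpace ℝ (Fin k)} {η : ℝ} {l : TangentSpace I x.1}
    (hl : g.IsMWAND x.1 l) (h : g.IsRicciTypeN x.1 η l) :
    (g.weylType x.1 ≠ .O → (g.prodEuclidean k).weylType x = g.weylType x.1) ∧
    (g.weylType x.1 = .O → (g.prodEuclidean k).weylType x = .N) ∧
    ∀ v, (g.prodEuclidean k).IsMWAND x v ↔ ∃ c : ℝ, c ≠ 0 ∧ v = c • lift x l := by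
  have hU := isOpen_extChartAt_target_prod_univ (I := I) x
  have hx := extChartAt_prod_self (I := I) x
  have hmem := mem_extChartAt_target_prod_univ (I := I) x
  have : Nontrivial (EuclideanSpace ℝ (Fin k)) :=
    Module.nontrivial_of_finrank_pos (R := ℝ) (by rw [finrank_euclideanSpace_fin]; omega)
  let B : E →ₗ[ℝ] E →ₗ[ℝ] ℝ :=
    ContinuousLinearMap.toLinearMap₁₂ (g.metric x.1 : E →L[ℝ] E →L[ℝ] ℝ)
  let B' : E × EuclideanSpace ℝ (Fin k) →ₗ[ℝ] E × EuclideanSpace ℝ (Fin k) →ₗ[ℝ] ℝ :=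
    ContinuousLinearMap.toLinearMap₁₂ ((g.prodEuclidean k).metric x :
      E × EuclideanSpace ℝ (Fin k) →L[ℝ] E × EuclideanSpace ℝ (Fin k) →L[ℝ] ℝ)
  have hB (u v : E) : B u v = B v u := g.symm x.1 u v
  have hB' (u v : E × EuclideanSpace ℝ (Fin k)) : B' u v = B u.1 v.1 + inner ℝ u.2 v.2 := by
    have := (g.isProdOn_coord x) _ hmem u v
    rw [← hx, coord_self] at this
    exact this.trans (congrArg (· + _) (congrArg (fun N : E →L[ℝ] E →L[ℝ] ℝ => N u.1 v.1)
      (g.coord_self x.1)))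
  have hm : IsMultilinear₄ (V := E) (g.weyl x.1) := by
    rw [g.weyl_apply]
    exact CoordMetric.weyl_isMultilinear₄ _ _
  -- Here genuineness of Ricci type N, `η ≠ 0`, enters.
  have hβ : η / ((Module.finrank ℝ (E × EuclideanSpace ℝ (Fin k)) : ℝ) - 2) ≠ 0 := by
    refine div_ne_zero h.1 (sub_ne_zero.2 ?_)
    rw [Module.finrank_prod]
    norm_cast
    omega
  have hll : g.coord x.1 (extChartAt I x.1 x.1) (l : E) (l : E) = 0 := by
    rw [coord_self]
    exact h.2.2.1
  have hW := (g.isProdOn_coord x).weyl_eq hU hmem hll h.ricci_coord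
  have hBc : B = (g.coord x.1 (extChartAt I x.1 x.1)).toLinearMap₁₂ := by
    rw [coord_self]
    rfl
  have hB'c : B' = ((g.prodEuclidean k).coord x (extChartAt I x.1 x.1, x.2)).toLinearMap₁₂ := by
    rw [← hx, coord_self]
    rfl
  have hW' (a b c d : E × EuclideanSpace ℝ (Fin k)) : (g.prodEuclidean k).weyl x a b c d =
      g.weyl x.1 a.1 b.1 c.1 d.1
        + η / ((Module.finrank ℝ E : ℝ) - 2) * nullKN B l a.1 b.1 c.1 d.1
        - η / ((Module.finrank ℝ (E × EuclideanSpace ℝ (Fin k)) : ℝ) - 2) *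
          nullKN B' (l, 0) a b c d := by
    rw [weyl_apply, weyl_apply, hx, hBc, hB'c]
    exact hW a b c d
  obtain ⟨e, he, -⟩ := id hl
  exact alignment_lift (V := E) hB hB' hm hβ hW' e
    (g.liftFrame x e (stdOrthonormalBasis ℝ (EuclideanSpace ℝ (Fin k)))) he
    (congrArg (lift x) he) (BoostOrderLE.vanishesAbove (V := E) hB hm hl)

end LorentzMetric

end

theorem proposition6 {m n : ℕ} (hm : 3 ≤ m) (hn : 1 ≤ n)
    {M : Type*} [TopologicalSpace M] [ChartedSpace (EuclideanSpace ℝ (Fin m)) M]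
    [IsManifold (𝓡 m) ∞ M] (g : LorentzMetric (𝓡 m) M)
    (l : ∀ p : M, TangentSpace (𝓡 m) p)
    (hl : ContMDiff (𝓡 m) (𝓡 m).tangent ∞ fun p => (⟨p, l p⟩ : TangentBundle (𝓡 m) M))
    (η : M → ℝ)
    (hWeyl : ∀ p, g.IsMWAND p (l p))
    (hRicci : ∀ p, g.IsRicciTypeN p (η p) (l p)) :
    -- (i) the Weyl type, and the mWAND of the product
    (∀ x : M × EuclideanSpace ℝ (Fin n),
      (g.weylType x.1 ≠ .O → (g.prodEuclidean n).weylType x = g.weylType x.1) ∧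
      (g.weylType x.1 = .O → (g.prodEuclidean n).weylType x = .N) ∧
      ∀ v, (g.prodEuclidean n).IsMWAND x v ↔
        ∃ c : ℝ, c ≠ 0 ∧ v = c • LorentzMetric.liftField n l x) ∧
    -- (ii) the Ricci tensor of the product is of type N, aligned with the mWAND
    (∀ x : M × EuclideanSpace ℝ (Fin n),
      (g.prodEuclidean n).IsRicciTypeN x (η x.1) (LorentzMetric.liftField n l x)) ∧
    -- (iii) the optical matrix in a lifted null frame
    (∀ (x : M × EuclideanSpace ℝ (Fin n)) {ι κ : Type} [Fintype ι] [DecidableEq ι]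
      [Fintype κ] [DecidableEq κ] (e : NullFrame (g.form x.1) ι)
      (f : OrthonormalBasis κ ℝ (EuclideanSpace ℝ (Fin n))), e.l = l x.1 →
      (g.prodEuclidean n).opticalMatrix (LorentzMetric.liftField n l) x (g.liftFrame x e f).m =
        Matrix.fromBlocks (g.opticalMatrix l x.1 e.m) 0 0 0) := by
  refine ⟨fun x => LorentzMetric.weylType_prodEuclidean ?_ hn (hWeyl x.1) (hRicci x.1),
    fun x => (hRicci x.1).prodEuclidean,
    fun x _ _ _ _ _ _ e f _ => g.opticalMatrix_liftFrame l x e f⟩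
  rw [finrank_euclideanSpace_fin]
  omega
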